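/- Fix $\alpha>1$. The WARM on a finite graph $G$ with edges labelled $1,\dots,n$ is the urn model with one colour per edge in which, at every step, a vertex of $G$ is chosen uniformly at random, $A\subset\{1,\dots,n\}$ is the set of edges incident to it, and an edge $i\in A$ is selected with probability proportional to (its current number of balls)$^{\alpha}$ and reinforced by one ball. With $p_A$ the probability of choosing the set $A$, put, for $v$ in the simplex $\{v\in\mathbb R^n: v_i\ge 0,\ \sum_i v_i=1\}$ (and, by the same formula, for $v\in[0,\infty)^n$), $$F(v)_i=-v_i+\lim_{t\to\infty}\sum_{A\ni i}p_A\frac{(v_it)^{\alpha}}{\sum_{j\in A}(v_jt)^{\alpha}} .$$ An equilibrium is a point $v$ of the simplex with $F(v)=0$. Let $\mathbf D(v)=(\partial F(v)_i/\partial v_k)_{i,k}$ (right derivatives where $v_k=0$). An equilibrium is linearly stable if all eigenvalues of $\mathbf D(v)$ have negative real part, linearly unstable if some eigenvalue has positive real part, and critical otherwise. **Theorem.** Consider the WARM on the triangle graph (three vertices, three edges), with $\alpha>1$. At every equilibrium all partial derivatives in $\mathbf D$ exist, and, up to permutation of the coordinates (that is, when the coordinates are listed in decreasing order), the equilibria are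 exactly the following: (i) $(1/3,1/3,1/3)$, for all $\alpha>1$; (ii) $(1/2,1/2,0)$, for all $\alpha>1$; (iii) $(v,u,0)$ for $\alpha>3$, where $v=v(\alpha)>u=1-v$, and $v(\alpha)$ is strictly increasing with $v(3+)=1/2$ and $v(+\infty)=2/3$; here $(v,u)$ is an equilibrium of the WARM on the line graph with two edges; (iv) $(v,v,u)$ for $1<\alpha\le 4/3$, where $u=1-2v$, $v>u$ if $\alpha<4/3$, and $v(\alpha)$ is strictly decreasing with $v(1+)=1/2$ and $v(4/3-)=v(4/3)=1/3$; (v) $(v,u,u)$ for $\alpha\ge 4/3$, where $u=(1-v)/2$, $v>u$ if $\alpha>4/3$, and $v(\alpha)$ is strictly increasing with $v(4/3)=v(4/3+)=1/3$ and $v(+\infty)=2/3$. For each $\alpha$ in the stated range, the value $v(\alpha)$ in each of (iii), (iv), (v) is unique. At $\alpha=4/3$ both (iv) and (v) coincide with (i). Stability: equilibrium (i) is linearly stable if and only if $\alpha<4/3$, and critical if and only if $\alpha=4/3$; equilibrium (ii) is linearly stable if and only if $\alpha<3$, and critical if and only if $\alpha=3$; equilibrium (iii) is linearly stable for all $\alpha>3$;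 equilibria (iv) and (v) are never linearly stable, and are critical if and only if $\alpha=4/3$. -/

import Mathlib

open Filter Topology Set

noncomputable section

/-- For `n` colours, subset law `p` (`p A` is the probability that the set of available colours
is `A`) and reinforcement function `W`, this is the vector field
`F(v)_i = - v_i + lim_{t → ∞} ∑_{A ∋ i} p_A W(v_i t) / ∑_{j ∈ A} W(v_j t)`.
(When `W x = x ^ α` and all `v_j ≥ 0`, the sum does not depend on `t > 0`, so the limit exists.) -/
def warmField {n : ℕ} (p : Finset (Fin n) → ℝ) (W : ℝ → ℝ) (v : Fin n → ℝ) (i : Fin n) : ℝ :=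
  -v i + limUnder atTop (fun t : ℝ =>
    ∑ A : Finset (Fin n) with i ∈ A, p A * (W (v i * t) / ∑ j ∈ A, W (v j * t)))

/-- A point of the simplex at which the field vanishes. -/
def IsEquilibrium {n : ℕ} (p : Finset (Fin n) → ℝ) (W : ℝ → ℝ) (v : Fin n → ℝ) : Prop :=
  v ∈ stdSimplex ℝ (Fin n) ∧ ∀ i, warmField p W v i = 0

/-- `D` is the matrix of partial derivatives `D i k = ∂ F(v)_i / ∂ v_k` (in particular they all
exist). The field is only meaningful for nonnegative coordinates, so the derivative is the
two-sided one where `v_k > 0` and the right derivative where `v_k = 0`. -/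
def HasJacobian {n : ℕ} (p : Finset (Fin n) → ℝ) (W : ℝ → ℝ) (v : Fin n → ℝ)
    (D : Matrix (Fin n) (Fin n) ℝ) : Prop :=
  ∀ i k, HasDerivWithinAt (fun x : ℝ => warmField p W (Function.update v k x) i) (D i k)
    (Ici 0) (v k)

/-- `z` is a complex eigenvalue of the real matrix `D`. -/
def IsComplexEigenvalue {n : ℕ} (D : Matrix (Fin n) (Fin n) ℝ) (z : ℂ) : Prop :=
  Module.End.HasEigenvalue (Matrix.toLin' (D.map (algebraMap ℝ ℂ))) z

/-- Equilibrium at which all eigenvalues of the Jacobian matrix have negative real part. -/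
def IsLinearlyStable {n : ℕ} (p : Finset (Fin n) → ℝ) (W : ℝ → ℝ) (v : Fin n → ℝ) : Prop :=
  IsEquilibrium p W v ∧ ∃ D, HasJacobian p W v D ∧ ∀ z, IsComplexEigenvalue D z → z.re < 0

/-- Equilibrium at which some eigenvalue of the Jacobian matrix has positive real part. -/
def IsLinearlyUnstable {n : ℕ} (p : Finset (Fin n) → ℝ) (W : ℝ → ℝ) (v : Fin n → ℝ) : Prop :=
  IsEquilibrium p W v ∧ ∃ D, HasJacobian p W v D ∧ ∃ z, IsComplexEigenvalue D z ∧ 0 < z.re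

/-- Equilibrium (with a Jacobian matrix) that is neither linearly stable nor linearly unstable. -/
def IsCritical {n : ℕ} (p : Finset (Fin n) → ℝ) (W : ℝ → ℝ) (v : Fin n → ℝ) : Prop :=
  IsEquilibrium p W v ∧ (∃ D, HasJacobian p W v D) ∧
    ¬ IsLinearlyStable p W v ∧ ¬ IsLinearlyUnstable p W v

/-- Subset law of the WARM on the graph `G`, whose edges are the colours, labelled by `e`:
a vertex `x` is uniformly chosen and the available colours are the edges incident to `x`. -/
def graphLaw {V : Type*} [Fintype V] [DecidableEq V] {n : ℕ} (G : SimpleGraph V)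
    (e : Fin n ≃ G.edgeSet) (A : Finset (Fin n)) : ℝ :=
  ((Finset.univ.filter (fun x : V =>
      Finset.univ.filter (fun i : Fin n => x ∈ (e i : Sym2 V)) = A)).card : ℝ) / Fintype.card V

/-- The triangle graph. -/
abbrev triangleGraph : SimpleGraph (Fin 3) := ⊤

/-- The line graph (path) with two edges. -/
abbrev twoEdgeGraph : SimpleGraph (Fin 3) := SimpleGraph.pathGraph 3

/-- The reinforcement function `x ↦ x ^ α`. -/
def powerWeight (α : ℝ) (x : ℝ) : ℝ := x ^ α

end

/-!
A point of the simplex proportional to `(1, 1, r)` or to `(r, 1, 0)` is an equilibrium of the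
triangle exactly when `r ^ α = q r` for an explicit rational function `q` with `q 1 = 1`. In the
variable `y = log r` this equation says that the line of slope `α` through the origin meets the
graph of `log (q (exp y))`. That function is strictly convex, its derivative being the increasing
elasticity of `q`, so besides `r = 1` there is at most one root, and it increases with `α`; the
exponent at which it passes through `1` and the limits at the ends of the range of `α` give the
branches (iii), (iv) and (v).

There are no other equilibria: if `a > b > c > 0` were one, then the convex function
`A ↦ A ^ (1 / α - 1)` would have decreasing secant slopes at `a ^ α`, `b ^ α`, `c ^ α`.

At both kinds of points the Jacobian matrix has real eigenvalues `-1` and `-1 + α / c`, where one of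
the constants `c` is the elasticity of `q` at `r`. The slope `α` of a chord from the origin lies
between the derivatives at its two ends, so convexity gives the sign of that eigenvalue for (iii)
and (iv). For (v) a second constant `c < 4 / 3 < α` makes the equilibrium unstable.
-/

/-! ### Roots of `r ^ α = q r` -/

section Monotone

variable {X Y : Type*} [LinearOrder X]

theorem strictMonoOn_invFunOn [Nonempty X] [Preorder Y] {φ : X → Y} {s : Set X} {t : Set Y}
    (hφ : StrictMonoOn φ s) (h : SurjOn φ s t) : StrictMonoOn (φ.invFunOn s) t := by
  intro a ha b hb hab
  rwa [← hφ.lt_iff_lt (h.mapsTo_invFunOn ha) (h.mapsTo_invFunOn hb), h.rightInvOn_invFunOn ha,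
    h.rightInvOn_invFunOn hb]

variable [LinearOrder Y] [DenselyOrdered Y] [TopologicalSpace Y] [OrderTopology Y] {f : X → Y}
  {a : X} {c d : Y}

theorem tendsto_atTop_of_image_Ioi_eq_Ioo [NoMaxOrder X] (hf : MonotoneOn f (Ioi a))
    (h : f '' Ioi a = Ioo c d) (hcd : c < d) : Tendsto f atTop (𝓝 d) := by
  refine tendsto_order.2 ⟨fun y hy => ?_, fun y hy => ?_⟩
  · obtain ⟨z, hz, hzd⟩ := exists_between (max_lt hy hcd)
    obtain ⟨x₀, hx₀, rfl⟩ := h.superset ⟨(le_max_right _ _).trans_lt hz, hzd⟩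
    filter_upwards [Ioi_mem_atTop x₀] with x hx
    exact ((le_max_left _ _).trans_lt hz).trans_le (hf hx₀ (hx₀.trans hx) (le_of_lt hx))
  · filter_upwards [Ioi_mem_atTop a] with x hx
    exact (h.subset (mem_image_of_mem f hx)).2.trans hy

theorem tendsto_nhdsGT_of_image_Ioi_eq_Ioo [TopologicalSpace X] [OrderTopology X]
    (hf : MonotoneOn f (Ioi a)) (h : f '' Ioi a = Ioo c d) (hcd : c < d) :
    Tendsto f (𝓝[>] a) (𝓝 c) := by
  refine tendsto_order.2 ⟨fun y hy => ?_, fun y hy => ?_⟩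
  · filter_upwards [self_mem_nhdsWithin] with x hx
    exact hy.trans (h.subset (mem_image_of_mem f hx)).1
  · obtain ⟨z, hcz, hz⟩ := exists_between (lt_min hy hcd)
    obtain ⟨x₀, hx₀, rfl⟩ := h.superset ⟨hcz, hz.trans_le (min_le_right _ _)⟩
    filter_upwards [Ioo_mem_nhdsGT hx₀] with x hx
    exact (hf hx.1 hx₀ hx.2.le).trans_lt (hz.trans_le (min_le_left _ _))

end Monotone

theorem strictMonoOn_dslope {f : ℝ → ℝ} {s : Set ℝ} {a f' : ℝ} (hf : StrictConvexOn ℝ s f)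
    (ha : a ∈ s) (hd : HasDerivAt f f' a) : StrictMonoOn (dslope f a) s := by
  intro x hx y hy hxy
  rcases eq_or_ne x a with rfl | hxa
  · rw [dslope_same, dslope_of_ne _ hxy.ne', hd.deriv]
    exact hf.lt_slope_of_hasDerivAt hx hy hxy hd
  rcases eq_or_ne y a with rfl | hya
  · rw [dslope_same, dslope_of_ne _ hxy.ne, hd.deriv, slope_comm]
    exact hf.slope_lt_of_hasDerivAt hx hy hxy hd
  · rw [dslope_of_ne _ hxa, dslope_of_ne _ hya, slope_def_field, slope_def_field]
    exact hf.secant_strict_mono ha hx hy hxa hya hxy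

/-- The exponent `α` with `r ^ α = q r`, for a function `q` with `q 1 = 1`. As a difference
quotient of `y ↦ log (q (exp y))` it extends to `r = 1`, where it is the logarithmic derivative. -/
noncomputable def powerExponent (q : ℝ → ℝ) (r : ℝ) : ℝ :=
  dslope (fun y => Real.log (q (Real.exp y))) 0 (Real.log r)

/-- `q` is a positive function with `q 1 = 1` whose elasticity `r * q' r / q r` equals `E r` and is
strictly increasing on the interval `s`. These are the functions for which `r ^ α = q r` has at most
one root `r ≠ 1`. -/
structure HasStrictMonoElasticity (q E : ℝ → ℝ) (s : Set ℝ) : Prop where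
  ordConnected : s.OrdConnected
  pos_of_mem : ∀ r ∈ s, 0 < r
  one_mem : 1 ∈ s
  map_one : q 1 = 1
  map_pos : ∀ r ∈ s, 0 < q r
  hasDerivAt : ∀ r ∈ s, HasDerivAt q (E r * q r / r) r
  strictMonoOn : StrictMonoOn E s

theorem powerExponent_eq_log_div_log {q : ℝ → ℝ} {r : ℝ} (hq : q 1 = 1) (hr : 0 < r)
    (hr1 : r ≠ 1) : powerExponent q r = Real.log (q r) / Real.log r := by
  rw [powerExponent, dslope_of_ne _ (Real.log_ne_zero_of_pos_of_ne_one hr hr1), slope_def_field,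
    Real.exp_zero, hq, Real.log_one, sub_zero, sub_zero, Real.exp_log hr]

theorem tendsto_powerExponent_nhdsGT_zero {q : ℝ → ℝ} {c : ℝ} (hq : q 1 = 1) (hc : 0 < c)
    (h : Tendsto (fun r => q r / r) (𝓝[>] 0) (𝓝 c)) :
    Tendsto (powerExponent q) (𝓝[>] 0) (𝓝 1) := by
  have hlog := (h.log hc.ne').div_atBot Real.tendsto_log_nhdsGT_zero
  refine (add_zero (1 : ℝ) ▸ hlog.const_add 1).congr' ?_
  filter_upwards [Ioo_mem_nhdsGT one_pos, h.eventually_ne hc.ne'] with r hr hqr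
  have hlogr : Real.log r ≠ 0 := (Real.log_neg hr.1 hr.2).ne
  rw [powerExponent_eq_log_div_log hq hr.1 hr.2.ne,
    Real.log_div (div_ne_zero_iff.1 hqr).1 hr.1.ne']
  field_simp
  ring

theorem tendsto_powerExponent_nhdsLT_atTop {q : ℝ → ℝ} {b : ℝ} (hq : q 1 = 1) (hb : 1 < b)
    (h : Tendsto q (𝓝[<] b) atTop) : Tendsto (powerExponent q) (𝓝[<] b) atTop := by
  have hlog : Tendsto (fun r => (Real.log r)⁻¹) (𝓝[<] b) (𝓝 (Real.log b)⁻¹) :=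
    ((Real.continuousAt_log (by positivity)).inv₀ (Real.log_pos hb).ne').mono_left
      nhdsWithin_le_nhds
  refine ((Real.tendsto_log_atTop.comp h).atTop_mul_pos
    (inv_pos.2 (Real.log_pos hb)) hlog).congr' ?_
  filter_upwards [nhdsWithin_le_nhds (Ioi_mem_nhds hb)] with r hr
  rw [powerExponent_eq_log_div_log hq (one_pos.trans hr) (ne_of_gt hr), Function.comp_apply,
    div_eq_mul_inv]

namespace HasStrictMonoElasticity

variable {q E : ℝ → ℝ} {s : Set ℝ} (h : HasStrictMonoElasticity q E s) {r α : ℝ}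
include h

theorem hasDerivAt_log_comp_exp {y : ℝ} (hy : Real.exp y ∈ s) :
    HasDerivAt (fun y => Real.log (q (Real.exp y))) (E (Real.exp y)) y := by
  have hq := (h.map_pos _ hy).ne'
  refine (((h.hasDerivAt _ hy).comp y (Real.hasDerivAt_exp y)).log hq).congr_deriv ?_
  rw [div_mul_cancel₀ _ (Real.exp_ne_zero y), Function.comp_apply, mul_div_cancel_right₀ _ hq]

theorem strictConvexOn_log_comp_exp :
    StrictConvexOn ℝ (Real.exp ⁻¹' s) fun y => Real.log (q (Real.exp y)) := by
  have hderiv : StrictMonoOn (deriv fun y => Real.log (q (Real.exp y))) (Real.exp ⁻¹' s) := by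
    intro x hx y hy hxy
    rw [(h.hasDerivAt_log_comp_exp hx).deriv, (h.hasDerivAt_log_comp_exp hy).deriv]
    exact h.strictMonoOn hx hy (Real.exp_lt_exp.2 hxy)
  exact StrictMonoOn.strictConvexOn_of_deriv
    (h.ordConnected.preimage_mono Real.exp_monotone).convex
    (fun y hy => (h.hasDerivAt_log_comp_exp hy).continuousAt.continuousWithinAt)
    (hderiv.mono interior_subset)

theorem log_mem (hr : r ∈ s) : Real.log r ∈ Real.exp ⁻¹' s := by
  rwa [mem_preimage, Real.exp_log (h.pos_of_mem r hr)]

theorem zero_mem : (0 : ℝ) ∈ Real.exp ⁻¹' s := by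
  rw [mem_preimage, Real.exp_zero]
  exact h.one_mem

theorem strictMonoOn_powerExponent : StrictMonoOn (powerExponent q) s := fun a ha _ hb hab =>
  strictMonoOn_dslope h.strictConvexOn_log_comp_exp h.zero_mem
    (h.hasDerivAt_log_comp_exp h.zero_mem) (h.log_mem ha) (h.log_mem hb)
    (Real.log_lt_log (h.pos_of_mem a ha) hab)

theorem powerExponent_one : powerExponent q 1 = E 1 := by
  rw [powerExponent, Real.log_one, dslope_same, (h.hasDerivAt_log_comp_exp h.zero_mem).deriv,
    Real.exp_zero]

theorem continuousOn_powerExponent : ContinuousOn (powerExponent q) s := by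
  intro r hr
  have hlog : ContinuousAt Real.log r := Real.continuousAt_log (h.pos_of_mem r hr).ne'
  have hd : DifferentiableAt ℝ (fun y => Real.log (q (Real.exp y))) (Real.log r) :=
    (h.hasDerivAt_log_comp_exp (h.log_mem hr)).differentiableAt
  refine (ContinuousAt.comp (g := dslope _ 0) ?_ hlog).continuousWithinAt
  rcases eq_or_ne (Real.log r) 0 with h0 | h0
  · rw [h0] at hd ⊢
    exact continuousAt_dslope_same.2 hd
  · exact (continuousAt_dslope_of_ne h0).2 hd.continuousAt

theorem rpow_eq_iff (hr : r ∈ s) (hr1 : r ≠ 1) : r ^ α = q r ↔ powerExponent q r = α := by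
  have hr0 := h.pos_of_mem r hr
  have hlog := Real.log_ne_zero_of_pos_of_ne_one hr0 hr1
  rw [powerExponent_eq_log_div_log h.map_one hr0 hr1, div_eq_iff hlog, ← Real.log_rpow hr0,
    eq_comm, Real.log_injOn_pos.eq_iff (h.map_pos r hr) (Real.rpow_pos_of_pos hr0 α)]

theorem powerExponent_lt (hr : r ∈ s) (hr1 : 1 < r) : powerExponent q r < E r := by
  have hlog := Real.log_pos hr1
  have := h.strictConvexOn_log_comp_exp.slope_lt_of_hasDerivAt h.zero_mem (h.log_mem hr) hlog
    (h.hasDerivAt_log_comp_exp (h.log_mem hr))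
  rwa [← dslope_of_ne _ hlog.ne', Real.exp_log (one_pos.trans hr1)] at this

theorem lt_powerExponent (hr : r ∈ s) (hr1 : r < 1) : E r < powerExponent q r := by
  have hr0 := h.pos_of_mem r hr
  have hlog := Real.log_neg hr0 hr1
  have := h.strictConvexOn_log_comp_exp.lt_slope_of_hasDerivAt (h.log_mem hr) h.zero_mem hlog
    (h.hasDerivAt_log_comp_exp (h.log_mem hr))
  rwa [slope_comm, ← dslope_of_ne _ hlog.ne, Real.exp_log hr0] at this

end HasStrictMonoElasticity

/-! ### Ratios of the coordinates -/

theorem tendsto_div_const_sub_nhdsLT_atTop {g : ℝ → ℝ} {b : ℝ} (hg : ContinuousAt g b)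
    (hb : 0 < g b) : Tendsto (fun r => g r / (b - r)) (𝓝[<] b) atTop := by
  have hsub : Tendsto (fun r => b - r) (𝓝[<] b) (𝓝[>] 0) := by
    refine tendsto_nhdsWithin_iff.2 ⟨?_, ?_⟩
    · have hcont : ContinuousAt (fun r => b - r) b := by fun_prop
      simpa only [sub_self] using hcont.tendsto.mono_left nhdsWithin_le_nhds
    · filter_upwards [self_mem_nhdsWithin] with r (hr : r < b)
      exact mem_Ioi.2 (sub_pos.2 hr)
  simpa only [div_eq_mul_inv, Function.comp_def] using
    (hg.mono_left nhdsWithin_le_nhds).pos_mul_atTop hb (tendsto_inv_nhdsGT_zero.comp hsub)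

section EqualPair

/-- The value that the equilibrium equations at a point proportional to `(1, 1, r)` prescribe for
`r ^ α`. -/
noncomputable def equalPairWeight (r : ℝ) : ℝ := 3 * r / (4 - r)

/-- The elasticity of `equalPairWeight`. -/
noncomputable def equalPairElasticity (r : ℝ) : ℝ := 4 / (4 - r)

theorem hasStrictMonoElasticity_equalPair :
    HasStrictMonoElasticity equalPairWeight equalPairElasticity (Ioo 0 4) where
  ordConnected := ordConnected_Ioo
  pos_of_mem _ hr := hr.1
  one_mem := by norm_num
  map_one := by norm_num [equalPairWeight]
  map_pos r hr := div_pos (by linarith [hr.1]) (by linarith [hr.2])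
  hasDerivAt r hr := by
    have h0 : r ≠ 0 := hr.1.ne'
    have h4 : 4 - r ≠ 0 := by linarith [hr.2]
    refine (((hasDerivAt_id r).const_mul 3).fun_div
      ((hasDerivAt_id r).const_sub 4) h4).congr_deriv ?_
    simp only [equalPairElasticity, equalPairWeight, id]
    field_simp
    ring
  strictMonoOn a _ b hb hab :=
    div_lt_div_of_pos_left (by norm_num) (by linarith [hb.2]) (by linarith)

theorem equalPairElasticity_one : equalPairElasticity 1 = 4 / 3 := by
  norm_num [equalPairElasticity]

theorem powerExponent_equalPair_one : powerExponent equalPairWeight 1 = 4 / 3 := by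
  rw [hasStrictMonoElasticity_equalPair.powerExponent_one, equalPairElasticity_one]

theorem one_lt_powerExponent_equalPair {r : ℝ} (hr : r ∈ Ioo (0 : ℝ) 4) :
    1 < powerExponent equalPairWeight r := by
  rcases lt_or_ge r 1 with hr1 | hr1
  · have hE : 1 < equalPairElasticity r :=
      (one_lt_div (by linarith [hr.2])).2 (by linarith [hr.1])
    exact hE.trans (hasStrictMonoElasticity_equalPair.lt_powerExponent hr hr1)
  · have := hasStrictMonoElasticity_equalPair.strictMonoOn_powerExponent.monotoneOn
      hasStrictMonoElasticity_equalPair.one_mem hr hr1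
    rw [powerExponent_equalPair_one] at this
    linarith

theorem bijOn_powerExponent_equalPair :
    BijOn (powerExponent equalPairWeight) (Ioo 0 4) (Ioi 1) := by
  have h := hasStrictMonoElasticity_equalPair
  refine ⟨fun r => one_lt_powerExponent_equalPair, h.strictMonoOn_powerExponent.injOn, ?_⟩
  refine isPreconnected_Ioo.intermediate_value_Ioi (l₁ := 𝓝[>] 0) (l₂ := 𝓝[<] 4)
    (le_principal_iff.2 (Ioo_mem_nhdsGT (by norm_num)))
    (le_principal_iff.2 (Ioo_mem_nhdsLT (by norm_num))) h.continuousOn_powerExponent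
    (tendsto_powerExponent_nhdsGT_zero (c := 3 / 4) h.map_one (by norm_num) ?_)
    (tendsto_powerExponent_nhdsLT_atTop h.map_one (by norm_num)
      (tendsto_div_const_sub_nhdsLT_atTop (g := fun r => 3 * r) (by fun_prop) (by norm_num)))
  have hcont : ContinuousAt (fun r : ℝ => 3 / (4 - r)) 0 := by
    fun_prop (disch := norm_num)
  have hlim : Tendsto (fun r : ℝ => 3 / (4 - r)) (𝓝[>] 0) (𝓝 (3 / 4)) := by
    simpa using hcont.tendsto.mono_left (nhdsWithin_le_nhds (s := Ioi 0))
  refine hlim.congr' (eventually_mem_nhdsWithin.mono fun r (hr : 0 < r) => ?_)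
  simp only [equalPairWeight]
  rw [div_right_comm, mul_div_cancel_right₀ _ hr.ne']

/-- The ratio of the third coordinate to the two equal ones at an equilibrium of the triangle with
three positive coordinates that are not all equal. -/
noncomputable def equalPairRatio : ℝ → ℝ := (powerExponent equalPairWeight).invFunOn (Ioo 0 4)

theorem equalPairRatio_mem {α : ℝ} (hα : 1 < α) : equalPairRatio α ∈ Ioo (0 : ℝ) 4 :=
  bijOn_powerExponent_equalPair.surjOn.mapsTo_invFunOn hα

theorem powerExponent_equalPairRatio {α : ℝ} (hα : 1 < α) :
    powerExponent equalPairWeight (equalPairRatio α) = α :=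
  bijOn_powerExponent_equalPair.surjOn.rightInvOn_invFunOn hα

theorem equalPairRatio_powerExponent {r : ℝ} (hr : r ∈ Ioo (0 : ℝ) 4) :
    equalPairRatio (powerExponent equalPairWeight r) = r :=
  bijOn_powerExponent_equalPair.injOn.leftInvOn_invFunOn hr

theorem equalPairRatio_four_thirds : equalPairRatio (4 / 3) = 1 := by
  rw [← powerExponent_equalPair_one, equalPairRatio_powerExponent (by norm_num)]

theorem strictMonoOn_equalPairRatio : StrictMonoOn equalPairRatio (Ioi 1) :=
  strictMonoOn_invFunOn hasStrictMonoElasticity_equalPair.strictMonoOn_powerExponent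
    bijOn_powerExponent_equalPair.surjOn

theorem image_equalPairRatio : equalPairRatio '' Ioi 1 = Ioo 0 4 := by
  rw [← bijOn_powerExponent_equalPair.image_eq]
  exact bijOn_powerExponent_equalPair.injOn.leftInvOn_invFunOn.image_image

theorem tendsto_equalPairRatio_nhdsGT_one : Tendsto equalPairRatio (𝓝[>] 1) (𝓝 0) :=
  tendsto_nhdsGT_of_image_Ioi_eq_Ioo strictMonoOn_equalPairRatio.monotoneOn image_equalPairRatio
    (by norm_num)

theorem tendsto_equalPairRatio_atTop : Tendsto equalPairRatio atTop (𝓝 4) :=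
  tendsto_atTop_of_image_Ioi_eq_Ioo strictMonoOn_equalPairRatio.monotoneOn image_equalPairRatio
    (by norm_num)

theorem tendsto_equalPairRatio_four_thirds : Tendsto equalPairRatio (𝓝 (4 / 3)) (𝓝 1) := by
  have hcont : ContinuousAt equalPairRatio (4 / 3) :=
    strictMonoOn_equalPairRatio.continuousAt_of_image_mem_nhds (Ioi_mem_nhds (by norm_num)) (by
      rw [image_equalPairRatio, equalPairRatio_four_thirds]
      exact Ioo_mem_nhds (by norm_num) (by norm_num))
  simpa only [equalPairRatio_four_thirds] using hcont.tendsto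

theorem equalPairRatio_lt_one_iff {α : ℝ} (hα : 1 < α) : equalPairRatio α < 1 ↔ α < 4 / 3 := by
  rw [← equalPairRatio_four_thirds]
  exact strictMonoOn_equalPairRatio.lt_iff_lt hα (by norm_num)

theorem one_lt_equalPairRatio_iff {α : ℝ} (hα : 1 < α) : 1 < equalPairRatio α ↔ 4 / 3 < α := by
  rw [← equalPairRatio_four_thirds]
  exact strictMonoOn_equalPairRatio.lt_iff_lt (by norm_num) hα

theorem equalPairElasticity_equalPairRatio_lt {α : ℝ} (hα : 1 < α) (hα' : α < 4 / 3) :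
    equalPairElasticity (equalPairRatio α) < α := by
  have := hasStrictMonoElasticity_equalPair.lt_powerExponent (equalPairRatio_mem hα)
    ((equalPairRatio_lt_one_iff hα).2 hα')
  rwa [powerExponent_equalPairRatio hα] at this

theorem lt_four_of_rpow_mul_four_sub_eq {α r : ℝ} (hr : 0 < r) (h : r ^ α * (4 - r) = 3 * r) :
    r < 4 :=
  sub_pos.1 (pos_of_mul_pos_right (h ▸ by positivity) (Real.rpow_pos_of_pos hr α).le)

theorem rpow_mul_four_sub_eq_iff {α r : ℝ} (hα : 1 < α) (hr : 0 < r) :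
    r ^ α * (4 - r) = 3 * r ↔ r = 1 ∨ r = equalPairRatio α := by
  have hmem : r ^ α * (4 - r) = 3 * r → r ∈ Ioo (0 : ℝ) 4 := fun h =>
    ⟨hr, lt_four_of_rpow_mul_four_sub_eq hr h⟩
  have hroot : ∀ {r}, r ∈ Ioo (0 : ℝ) 4 → r ≠ 1 →
      (r ^ α * (4 - r) = 3 * r ↔ powerExponent equalPairWeight r = α) := fun {r} hr hr1 => by
    rw [← hasStrictMonoElasticity_equalPair.rpow_eq_iff hr hr1, equalPairWeight,
      eq_div_iff (by linarith [hr.2])]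
  rcases eq_or_ne r 1 with rfl | hr1
  · norm_num
  · rw [or_iff_right hr1]
    constructor
    · intro h
      rw [← (hroot (hmem h) hr1).1 h, equalPairRatio_powerExponent (hmem h)]
    · rintro rfl
      exact (hroot (equalPairRatio_mem hα) hr1).2 (powerExponent_equalPairRatio hα)

end EqualPair

section OneZero

/-- The value that the equilibrium equations at a point proportional to `(r, 1, 0)` prescribe for
`r ^ α`. -/
noncomputable def oneZeroWeight (r : ℝ) : ℝ := (2 * r - 1) / (2 - r)

/-- The elasticity of `oneZeroWeight`. -/
noncomputable def oneZeroElasticity (r : ℝ) : ℝ := 3 * r / ((2 * r - 1) * (2 - r))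

theorem hasStrictMonoElasticity_oneZero :
    HasStrictMonoElasticity oneZeroWeight oneZeroElasticity (Ico 1 2) where
  ordConnected := ordConnected_Ico
  pos_of_mem _ hr := one_pos.trans_le hr.1
  one_mem := by norm_num
  map_one := by norm_num [oneZeroWeight]
  map_pos r hr := div_pos (by linarith [hr.1]) (by linarith [hr.2])
  hasDerivAt r hr := by
    have h0 : r ≠ 0 := by linarith [hr.1]
    have h1 : 2 * r - 1 ≠ 0 := by linarith [hr.1]
    have h2 : 2 - r ≠ 0 := by linarith [hr.2]
    refine ((((hasDerivAt_id r).const_mul 2).sub_const 1).fun_div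
      ((hasDerivAt_id r).const_sub 2) h2).congr_deriv ?_
    simp only [oneZeroElasticity, oneZeroWeight, id]
    field_simp
    ring
  strictMonoOn := by
    rintro a ⟨ha, _⟩ b ⟨_, hb⟩ hab
    have hab' : 0 < a * b - 1 := by nlinarith
    rw [oneZeroElasticity, oneZeroElasticity, div_lt_div_iff₀
      (mul_pos (by linarith) (by linarith)) (mul_pos (by linarith) (by linarith))]
    nlinarith [mul_pos hab' (sub_pos.2 hab)]

theorem oneZeroElasticity_one : oneZeroElasticity 1 = 3 := by
  norm_num [oneZeroElasticity]

theorem bijOn_powerExponent_oneZero :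
    BijOn (powerExponent oneZeroWeight) (Ioo 1 2) (Ioi 3) := by
  have h := hasStrictMonoElasticity_oneZero
  have hone : powerExponent oneZeroWeight 1 = 3 := by
    rw [h.powerExponent_one, oneZeroElasticity_one]
  have hlim : Tendsto (powerExponent oneZeroWeight) (𝓝[<] 2) atTop :=
    tendsto_powerExponent_nhdsLT_atTop h.map_one (by norm_num)
      (tendsto_div_const_sub_nhdsLT_atTop (g := fun r => 2 * r - 1) (by fun_prop) (by norm_num))
  refine ⟨fun r hr => ?_, h.strictMonoOn_powerExponent.injOn.mono Ioo_subset_Ico_self, ?_⟩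
  · rw [mem_Ioi, ← hone]
    exact h.strictMonoOn_powerExponent h.one_mem (Ioo_subset_Ico_self hr) hr.1
  · intro α hα
    obtain ⟨r, hr, rfl⟩ := isPreconnected_Ico.intermediate_value_Ici h.one_mem
      (le_principal_iff.2 (Ico_mem_nhdsLT one_lt_two)) h.continuousOn_powerExponent hlim
      (hone.trans_le (le_of_lt hα))
    refine mem_image_of_mem _ ⟨hr.1.lt_of_ne ?_, hr.2⟩
    rintro rfl
    exact hα.ne' hone

/-- The ratio of the larger to the smaller positive coordinate at an equilibrium of the triangle
with two distinct positive coordinates and one zero. -/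
noncomputable def oneZeroRatio : ℝ → ℝ := (powerExponent oneZeroWeight).invFunOn (Ioo 1 2)

theorem oneZeroRatio_mem {α : ℝ} (hα : 3 < α) : oneZeroRatio α ∈ Ioo (1 : ℝ) 2 :=
  bijOn_powerExponent_oneZero.surjOn.mapsTo_invFunOn hα

theorem powerExponent_oneZeroRatio {α : ℝ} (hα : 3 < α) :
    powerExponent oneZeroWeight (oneZeroRatio α) = α :=
  bijOn_powerExponent_oneZero.surjOn.rightInvOn_invFunOn hα

theorem oneZeroRatio_powerExponent {r : ℝ} (hr : r ∈ Ioo (1 : ℝ) 2) :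
    oneZeroRatio (powerExponent oneZeroWeight r) = r :=
  bijOn_powerExponent_oneZero.injOn.leftInvOn_invFunOn hr

theorem strictMonoOn_oneZeroRatio : StrictMonoOn oneZeroRatio (Ioi 3) :=
  strictMonoOn_invFunOn
    (hasStrictMonoElasticity_oneZero.strictMonoOn_powerExponent.mono Ioo_subset_Ico_self)
    bijOn_powerExponent_oneZero.surjOn

theorem image_oneZeroRatio : oneZeroRatio '' Ioi 3 = Ioo 1 2 := by
  rw [← bijOn_powerExponent_oneZero.image_eq]
  exact bijOn_powerExponent_oneZero.injOn.leftInvOn_invFunOn.image_image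

theorem tendsto_oneZeroRatio_nhdsGT_three : Tendsto oneZeroRatio (𝓝[>] 3) (𝓝 1) :=
  tendsto_nhdsGT_of_image_Ioi_eq_Ioo strictMonoOn_oneZeroRatio.monotoneOn image_oneZeroRatio
    one_lt_two

theorem tendsto_oneZeroRatio_atTop : Tendsto oneZeroRatio atTop (𝓝 2) :=
  tendsto_atTop_of_image_Ioi_eq_Ioo strictMonoOn_oneZeroRatio.monotoneOn image_oneZeroRatio
    one_lt_two

theorem lt_oneZeroElasticity_oneZeroRatio {α : ℝ} (hα : 3 < α) :
    α < oneZeroElasticity (oneZeroRatio α) := by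
  have hmem := oneZeroRatio_mem hα
  have := hasStrictMonoElasticity_oneZero.powerExponent_lt (Ioo_subset_Ico_self hmem) hmem.1
  rwa [powerExponent_oneZeroRatio hα] at this

theorem rpow_mul_two_sub_eq_iff {α r : ℝ} (hr : 1 < r) :
    r ^ α * (2 - r) = 2 * r - 1 ↔ 3 < α ∧ r = oneZeroRatio α := by
  have hmem : r ^ α * (2 - r) = 2 * r - 1 → r ∈ Ioo (1 : ℝ) 2 := fun h =>
    ⟨hr, sub_pos.1 (pos_of_mul_pos_right (h ▸ by linarith)
      (Real.rpow_pos_of_pos (one_pos.trans hr) α).le)⟩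
  have hroot : ∀ {r}, r ∈ Ioo (1 : ℝ) 2 →
      (r ^ α * (2 - r) = 2 * r - 1 ↔ powerExponent oneZeroWeight r = α) := fun {r} hr => by
    rw [← hasStrictMonoElasticity_oneZero.rpow_eq_iff (Ioo_subset_Ico_self hr) hr.1.ne',
      oneZeroWeight, eq_div_iff (by linarith [hr.2])]
  constructor
  · intro h
    have hr := hmem h
    rw [← (hroot hr).1 h, oneZeroRatio_powerExponent hr]
    exact ⟨bijOn_powerExponent_oneZero.mapsTo hr, rfl⟩
  · rintro ⟨hα, rfl⟩
    exact (hroot (oneZeroRatio_mem hα)).2 (powerExponent_oneZeroRatio hα)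

end OneZero

/-! ### The equations of the triangle -/

section Field

theorem warmField_powerWeight {n : ℕ} (p : Finset (Fin n) → ℝ) (α : ℝ) {v : Fin n → ℝ}
    (hv : ∀ i, 0 ≤ v i) (i : Fin n) :
    warmField p (powerWeight α) v i =
      -v i + ∑ A : Finset (Fin n) with i ∈ A, p A * (v i ^ α / ∑ j ∈ A, v j ^ α) := by
  rw [warmField]
  congr 1
  refine Tendsto.limUnder_eq (tendsto_const_nhds.congr' ?_)
  filter_upwards [Ioi_mem_atTop 0] with t (ht : 0 < t)
  refine Finset.sum_congr rfl fun A _ => ?_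
  simp only [powerWeight, Real.mul_rpow (hv _) ht.le, ← Finset.sum_mul]
  rw [mul_div_mul_right _ _ (Real.rpow_pos_of_pos ht α).ne']

theorem sum_graphLaw_mul {V : Type*} [Fintype V] [DecidableEq V] {n : ℕ} (G : SimpleGraph V)
    (e : Fin n ≃ G.edgeSet) (g : Finset (Fin n) → ℝ) (i : Fin n) :
    ∑ A : Finset (Fin n) with i ∈ A, graphLaw G e A * g A =
      (∑ x : V with x ∈ (e i : Sym2 V),
        g (Finset.univ.filter fun j => x ∈ (e j : Sym2 V))) / Fintype.card V := by
  simp only [graphLaw, Finset.card_filter, Nat.cast_sum, Nat.cast_ite, Nat.cast_one, Nat.cast_zero,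
    div_mul_eq_mul_div, ← Finset.sum_div, Finset.sum_mul, ite_mul, one_mul, zero_mul]
  congr 1
  rw [Finset.sum_comm, Finset.sum_filter]
  refine Finset.sum_congr rfl fun x _ => ?_
  rw [Finset.sum_ite_eq]
  simp only [Finset.mem_filter, Finset.mem_univ, true_and]

theorem warmField_graphLaw {V : Type*} [Fintype V] [DecidableEq V] {n : ℕ} {G : SimpleGraph V}
    (e : Fin n ≃ G.edgeSet) (α : ℝ) {v : Fin n → ℝ} (hv : ∀ i, 0 ≤ v i) (i : Fin n) :
    warmField (graphLaw G e) (powerWeight α) v i =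
      -v i + (∑ x : V with x ∈ (e i : Sym2 V),
        v i ^ α / ∑ j with x ∈ (e j : Sym2 V), v j ^ α) / Fintype.card V := by
  rw [warmField_powerWeight _ _ hv,
    sum_graphLaw_mul G e (fun A => v i ^ α / ∑ j ∈ A, v j ^ α)]

end Field

section Share

/-- The probability that the first of two colours wins when they compete with `a` and `b` balls. -/
noncomputable def share (α a b : ℝ) : ℝ := a ^ α / (a ^ α + b ^ α)

/-- The variance of the indicator that the first of two colours wins; up to the factor `α / a` it
is the derivative of `share` in `a`. -/
noncomputable def shareVariance (α a b : ℝ) : ℝ := share α a b * share α b a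

theorem shareVariance_comm (α a b : ℝ) : shareVariance α a b = shareVariance α b a :=
  mul_comm _ _

theorem share_div_div {α a b c : ℝ} (ha : 0 ≤ a) (hb : 0 ≤ b) (hc : 0 < c) :
    share α (a / c) (b / c) = share α a b := by
  rw [share, Real.div_rpow ha hc.le, Real.div_rpow hb hc.le, ← add_div,
    div_div_div_cancel_right₀ (Real.rpow_pos_of_pos hc α).ne', share]

theorem share_self {α a : ℝ} (ha : 0 < a) : share α a a = 1 / 2 := by
  have := Real.rpow_pos_of_pos ha α
  rw [share]
  field_simp
  norm_num

theorem share_zero_right {α a : ℝ} (hα : α ≠ 0) (ha : 0 < a) : share α a 0 = 1 := by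
  rw [share, Real.zero_rpow hα, add_zero, div_self (Real.rpow_pos_of_pos ha α).ne']

theorem share_zero_left {α a : ℝ} (hα : α ≠ 0) : share α 0 a = 0 := by
  rw [share, Real.zero_rpow hα, zero_div]

theorem share_le_one {α a b : ℝ} (ha : 0 ≤ a) (hb : 0 ≤ b) : share α a b ≤ 1 :=
  div_le_one_of_le₀ (le_add_of_nonneg_right (Real.rpow_nonneg hb α))
    (add_nonneg (Real.rpow_nonneg ha α) (Real.rpow_nonneg hb α))

-- At `a = 0` both sides vanish: `0 ^ (α - 1) = 0` on the left and `α / 0 = 0` on the right.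
theorem mul_rpow_sub_one_div_sq_eq {α a : ℝ} (b : ℝ) (hα : 1 < α) (ha : 0 ≤ a) :
    α * a ^ (α - 1) * b ^ α / (a ^ α + b ^ α) ^ 2 = α / a * shareVariance α a b := by
  rcases ha.eq_or_lt with rfl | ha
  · simp [Real.zero_rpow (sub_ne_zero.2 hα.ne')]
  · rw [Real.rpow_sub_one ha.ne', shareVariance, share, share, add_comm (b ^ α)]
    field_simp

theorem hasDerivAt_share_left {α a b : ℝ} (hα : 1 < α) (ha : 0 ≤ a) (hab : a ^ α + b ^ α ≠ 0) :
    HasDerivAt (fun x => share α x b) (α / a * shareVariance α a b) a := by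
  have h := Real.hasDerivAt_rpow_const (x := a) (Or.inr hα.le)
  refine (h.fun_div (h.add_const (b ^ α)) hab).congr_deriv ?_
  rw [← mul_rpow_sub_one_div_sq_eq b hα ha]
  ring

theorem hasDerivAt_share_right {α a b : ℝ} (hα : 1 < α) (hb : 0 ≤ b) (hab : a ^ α + b ^ α ≠ 0) :
    HasDerivAt (fun x => share α a x) (-(α / b * shareVariance α a b)) b := by
  have h := Real.hasDerivAt_rpow_const (x := b) (Or.inr hα.le)
  refine ((hasDerivAt_const b (a ^ α)).fun_div (h.const_add (a ^ α)) hab).congr_deriv ?_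
  rw [shareVariance_comm, ← mul_rpow_sub_one_div_sq_eq a hα hb]
  ring

end Share

section Triangle

theorem exists_oppositeVertex (e : Fin 3 ≃ triangleGraph.edgeSet) :
    ∃ τ : Fin 3 ≃ Fin 3, ∀ x i, x ∈ (e i : Sym2 (Fin 3)) ↔ x ≠ τ i := by
  have hopp : ∀ s : Sym2 (Fin 3), ¬ s.IsDiag → ∃ y, ∀ x, x ∈ s ↔ x ≠ y := by decide
  choose τ hτ using fun i => hopp _ (SimpleGraph.not_isDiag_of_mem_edgeSet _ (e i).2)
  have hinj : Function.Injective τ := fun i j hij =>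
    e.injective (Subtype.ext (Sym2.ext fun x => by rw [hτ, hτ, hij]))
  exact ⟨Equiv.ofBijective τ (Finite.injective_iff_bijective.1 hinj), fun x i => hτ i x⟩

theorem warmField_triangleGraph (e : Fin 3 ≃ triangleGraph.edgeSet) (α : ℝ) {v : Fin 3 → ℝ}
    (hv : ∀ i, 0 ≤ v i) (i : Fin 3) :
    warmField (graphLaw triangleGraph e) (powerWeight α) v i =
      -v i + (∑ j with j ≠ i, share α (v i) (v j)) / 3 := by
  obtain ⟨τ, hτ⟩ := exists_oppositeVertex e
  rw [warmField_graphLaw e α hv]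
  simp only [hτ, Fintype.card_fin, Nat.cast_ofNat]
  congr 2
  rw [Finset.sum_filter, ← Equiv.sum_comp τ]
  simp only [ne_eq, EmbeddingLike.apply_eq_iff_eq, Finset.sum_filter, Fin.sum_univ_three, share]
  fin_cases i <;> simp <;> ring

theorem warmField_twoEdgeGraph (e : Fin 2 ≃ twoEdgeGraph.edgeSet) (α : ℝ) {v : Fin 2 → ℝ}
    (hv : ∀ i, 0 < v i) (i : Fin 2) :
    warmField (graphLaw twoEdgeGraph e) (powerWeight α) v i =
      -v i + (1 + share α (v i) (v (1 - i))) / 3 := by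
  have hedge : ∀ s ∈ twoEdgeGraph.edgeSet, s = s(1, 0) ∨ s = s(1, 2) := by
    intro s
    induction s with | _ x y
    fin_cases x <;> fin_cases y <;> simp [SimpleGraph.pathGraph_adj]
  have hne : (e 0 : Sym2 (Fin 3)) ≠ e 1 := fun h => by simpa using e.injective (Subtype.ext h)
  have hpos := fun i => (Real.rpow_pos_of_pos (hv i) α).ne'
  rw [warmField_graphLaw e α fun i => (hv i).le]
  simp only [Fintype.card_fin, Nat.cast_ofNat, Finset.sum_filter, Fin.sum_univ_three, share]
  congr 2
  rcases hedge _ (e 0).2 with h0 | h0 <;> rcases hedge _ (e 1).2 with h1 | h1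
  · exact absurd (h0.trans h1.symm) hne
  · fin_cases i <;> simp [h0, h1, hpos]
    ring
  · fin_cases i <;> simp [h0, h1, hpos] <;> ring
  · exact absurd (h0.trans h1.symm) hne

theorem sum_filter_ne_comp_perm {ι M : Type*} [Fintype ι] [DecidableEq ι] [AddCommMonoid M]
    (σ : Equiv.Perm ι) (f : ι → M) (i : ι) :
    ∑ j with j ≠ i, f (σ j) = ∑ j with j ≠ σ i, f j :=
  Finset.sum_equiv σ (by simp) fun _ _ => rfl

/-- The equilibrium equations of the WARM on the triangle. -/
def IsTriangleEquilibrium (α : ℝ) (v : Fin 3 → ℝ) : Prop :=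
  v ∈ stdSimplex ℝ (Fin 3) ∧ ∀ i, 3 * v i = ∑ j with j ≠ i, share α (v i) (v j)

theorem isEquilibrium_triangleGraph_iff (e : Fin 3 ≃ triangleGraph.edgeSet) (α : ℝ)
    (v : Fin 3 → ℝ) :
    IsEquilibrium (graphLaw triangleGraph e) (powerWeight α) v ↔ IsTriangleEquilibrium α v := by
  refine and_congr_right fun hv => forall_congr' fun i => ?_
  rw [warmField_triangleGraph e α hv.1]
  constructor <;> intro h <;> linarith

theorem isTriangleEquilibrium_vec_iff {α a b c : ℝ} :
    IsTriangleEquilibrium α ![a, b, c] ↔ ((0 ≤ a ∧ 0 ≤ b ∧ 0 ≤ c) ∧ a + b + c = 1) ∧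
      3 * a = share α a b + share α a c ∧ 3 * b = share α b a + share α b c ∧
      3 * c = share α c a + share α c b := by
  simp [IsTriangleEquilibrium, stdSimplex, Fin.forall_fin_succ, Fin.sum_univ_three,
    Finset.sum_filter]

theorem isTriangleEquilibrium_comp_perm_iff {α : ℝ} {v : Fin 3 → ℝ} (σ : Equiv.Perm (Fin 3)) :
    IsTriangleEquilibrium α (v ∘ σ) ↔ IsTriangleEquilibrium α v := by
  refine and_congr ?_ ?_
  · simp only [stdSimplex, mem_ofPred_eq, Function.comp_apply, Equiv.sum_comp σ v]
    exact and_congr_left' (σ.forall_congr_right (q := fun i => 0 ≤ v i))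
  · rw [← σ.forall_congr_right (q := fun i => 3 * v i = ∑ j with j ≠ i, share α (v i) (v j))]
    refine forall_congr' fun i => ?_
    rw [← sum_filter_ne_comp_perm σ fun j => share α (v (σ i)) (v j)]
    rfl

/-- The matrix of partial derivatives of the field of the triangle. At `v k = 0` the convention
`α / 0 = 0` gives the correct right derivatives, which vanish because `1 < α`. -/
noncomputable def triangleJacobian (α : ℝ) (v : Fin 3 → ℝ) : Matrix (Fin 3) (Fin 3) ℝ :=
  Matrix.of fun i k =>
    if i = k then -1 + (∑ j with j ≠ i, α / v i * shareVariance α (v i) (v j)) / 3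
    else -(α / v k * shareVariance α (v i) (v k)) / 3

theorem hasJacobian_triangleJacobian (e : Fin 3 ≃ triangleGraph.edgeSet) {α : ℝ} (hα : 1 < α)
    {v : Fin 3 → ℝ} (hv : ∀ i, 0 ≤ v i) (hv2 : ∀ i j, i ≠ j → v i ^ α + v j ^ α ≠ 0) :
    HasJacobian (graphLaw triangleGraph e) (powerWeight α) v (triangleJacobian α v) := by
  intro i k
  have hupd : ∀ x ∈ Ici (0 : ℝ), 0 ≤ Function.update v k x := fun x hx =>
    le_update_iff.2 ⟨hx, fun j _ => hv j⟩
  refine HasDerivWithinAt.congr_of_mem (HasDerivAt.hasDerivWithinAt ?_)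
    (fun x hx => warmField_triangleGraph e α (hupd x hx) i) (hv k)
  rcases eq_or_ne i k with rfl | hik
  · simp only [triangleJacobian, Matrix.of_apply, if_true, Function.update_self]
    refine (hasDerivAt_neg _).add (HasDerivAt.div_const (HasDerivAt.fun_sum fun j hj => ?_) 3)
    have hj : j ≠ i := (Finset.mem_filter.1 hj).2
    simp only [Function.update_of_ne hj]
    exact hasDerivAt_share_left hα (hv i) (hv2 i j hj.symm)
  · simp only [triangleJacobian, Matrix.of_apply, if_neg hik, Function.update_of_ne hik]
    refine HasDerivAt.const_add _ (HasDerivAt.div_const ?_ 3)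
    have hsum : ∀ d : ℝ, d = ∑ j : Fin 3 with j ≠ i, if j = k then d else 0 := fun d => by
      simp [Finset.sum_ite_eq', hik.symm]
    rw [hsum (-_)]
    refine HasDerivAt.fun_sum fun j _ => ?_
    rcases eq_or_ne j k with rfl | hjk
    · simp only [Function.update_self, if_true]
      exact hasDerivAt_share_right hα (hv j) (hv2 i j hik)
    · simp only [Function.update_of_ne hjk, if_neg hjk]
      exact hasDerivAt_const _ _

theorem IsTriangleEquilibrium.three_mul_le_two {α : ℝ} {v : Fin 3 → ℝ}
    (h : IsTriangleEquilibrium α v) (i : Fin 3) : 3 * v i ≤ 2 := by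
  rw [h.2 i]
  refine (Finset.sum_le_card_nsmul _ _ 1 fun j _ => share_le_one (h.1.1 i) (h.1.1 j)).trans ?_
  simp [Finset.filter_ne']

theorem IsTriangleEquilibrium.rpow_add_rpow_ne_zero {α : ℝ} {v : Fin 3 → ℝ}
    (h : IsTriangleEquilibrium α v) (hα : α ≠ 0) {i j : Fin 3} (hij : i ≠ j) :
    v i ^ α + v j ^ α ≠ 0 := by
  intro h0
  obtain ⟨hi, hj⟩ := (add_eq_zero_iff_of_nonneg (Real.rpow_nonneg (h.1.1 i) α)
    (Real.rpow_nonneg (h.1.1 j) α)).1 h0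
  rw [Real.rpow_eq_zero (h.1.1 _) hα] at hi hj
  have hsum := h.1.2
  rw [Fin.sum_univ_three] at hsum
  have h0 := h.three_mul_le_two 0
  have h1 := h.three_mul_le_two 1
  have h2 := h.three_mul_le_two 2
  fin_cases i <;> fin_cases j <;> simp at hij hi hj <;> linarith

theorem IsTriangleEquilibrium.hasJacobian {α : ℝ} {v : Fin 3 → ℝ}
    (h : IsTriangleEquilibrium α v) (hα : 1 < α) (e : Fin 3 ≃ triangleGraph.edgeSet) :
    HasJacobian (graphLaw triangleGraph e) (powerWeight α) v (triangleJacobian α v) :=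
  hasJacobian_triangleJacobian e hα h.1.1 fun _ _ hij =>
    h.rpow_add_rpow_ne_zero (zero_lt_one.trans hα).ne' hij

open Polynomial in
theorem charpoly_triangleJacobian_comp_perm (α : ℝ) (v : Fin 3 → ℝ) (σ : Equiv.Perm (Fin 3)) :
    (triangleJacobian α (v ∘ σ)).charpoly = (triangleJacobian α v).charpoly := by
  rw [← Matrix.charpoly_reindex σ.symm (triangleJacobian α v)]
  congr 1
  ext i k
  simp only [triangleJacobian, Matrix.reindex_apply, Matrix.submatrix_apply, Matrix.of_apply,
    Equiv.symm_symm, Function.comp_apply, EmbeddingLike.apply_eq_iff_eq]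
  rw [sum_filter_ne_comp_perm σ fun j => α / v (σ i) * shareVariance α (v (σ i)) (v j)]

theorem eval_charpoly_triangleJacobian (α a b c t : ℝ) :
    (triangleJacobian α ![a, b, c]).charpoly.eval t =
      (t + 1) * ((t + 1) ^ 2 - α / 3 * ((shareVariance α a b + shareVariance α a c) / a +
          (shareVariance α a b + shareVariance α b c) / b +
          (shareVariance α a c + shareVariance α b c) / c) * (t + 1) +
        (α / 3) ^ 2 * (shareVariance α a b * shareVariance α a c +
          shareVariance α a b * shareVariance α b c + shareVariance α a c * shareVariance α b c) *
          (1 / (a * b) + 1 / (a * c) + 1 / (b * c))) := by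
  rw [Matrix.eval_charpoly, Matrix.det_fin_three]
  simp only [Matrix.scalar_apply, triangleJacobian, ne_eq, Finset.sum_filter, ite_not,
    Fin.sum_univ_three, Fin.isValue, Matrix.cons_val_zero, Matrix.cons_val_one, Matrix.cons_val,
    Matrix.sub_apply, Matrix.diagonal_apply_eq, Matrix.of_apply, ↓reduceIte, one_ne_zero, zero_add,
    Fin.reduceEq, zero_ne_one, shareVariance_comm α b a, add_zero, shareVariance_comm α c a,
    shareVariance_comm α c b, not_false_eq_true, Matrix.diagonal_apply_ne, zero_sub, mul_neg,
    neg_mul, neg_neg, one_div, mul_inv_rev]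
  ring

end Triangle

/-! ### Real spectra and stability -/

section Stability

open Polynomial

variable {n : ℕ} {p : Finset (Fin n) → ℝ} {W : ℝ → ℝ} {v : Fin n → ℝ}
  {D D' : Matrix (Fin n) (Fin n) ℝ} {s : Multiset ℝ}

theorem HasJacobian.unique (hv : ∀ i, 0 ≤ v i) (h : HasJacobian p W v D)
    (h' : HasJacobian p W v D') : D = D' := by
  ext i k
  exact (uniqueDiffOn_Ici 0 (v k) (hv k)).eq_deriv _ (h i k) (h' i k)

theorem isComplexEigenvalue_iff_of_charpoly_eq_prod
    (hs : D.charpoly = (s.map fun a => X - C a).prod) {z : ℂ} :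
    IsComplexEigenvalue D z ↔ ∃ a ∈ s, (a : ℂ) = z := by
  rw [IsComplexEigenvalue, Module.End.hasEigenvalue_iff_isRoot_charpoly, Matrix.charpoly_toLin',
    Matrix.charpoly_map, hs, IsRoot.def, Polynomial.map_multiset_prod, eval_multiset_prod,
    Multiset.prod_eq_zero_iff]
  simp [sub_eq_zero, eq_comm]

theorem isLinearlyStable_iff_of_charpoly_eq_prod (hv : IsEquilibrium p W v)
    (hD : HasJacobian p W v D) (hs : D.charpoly = (s.map fun a => X - C a).prod) :
    IsLinearlyStable p W v ↔ ∀ a ∈ s, a < 0 := by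
  refine (and_iff_right hv).trans ⟨?_, fun h => ⟨D, hD, fun z hz => ?_⟩⟩
  · rintro ⟨D', hD', h⟩ a ha
    obtain rfl := hD.unique hv.1.1 hD'
    exact h a ((isComplexEigenvalue_iff_of_charpoly_eq_prod hs).2 ⟨a, ha, rfl⟩)
  · obtain ⟨a, ha, rfl⟩ := (isComplexEigenvalue_iff_of_charpoly_eq_prod hs).1 hz
    exact h a ha

theorem isLinearlyUnstable_iff_of_charpoly_eq_prod (hv : IsEquilibrium p W v)
    (hD : HasJacobian p W v D) (hs : D.charpoly = (s.map fun a => X - C a).prod) :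
    IsLinearlyUnstable p W v ↔ ∃ a ∈ s, 0 < a := by
  refine (and_iff_right hv).trans ⟨?_, fun ⟨a, ha, hpos⟩ =>
    ⟨D, hD, a, (isComplexEigenvalue_iff_of_charpoly_eq_prod hs).2 ⟨a, ha, rfl⟩, hpos⟩⟩
  rintro ⟨D', hD', z, hz, hpos⟩
  obtain rfl := hD.unique hv.1.1 hD'
  obtain ⟨a, ha, rfl⟩ := (isComplexEigenvalue_iff_of_charpoly_eq_prod hs).1 hz
  exact ⟨a, ha, hpos⟩

theorem isCritical_iff_of_charpoly_eq_prod (hv : IsEquilibrium p W v)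
    (hD : HasJacobian p W v D) (hs : D.charpoly = (s.map fun a => X - C a).prod) :
    IsCritical p W v ↔ (∀ a ∈ s, a ≤ 0) ∧ 0 ∈ s := by
  rw [IsCritical, and_iff_right hv, and_iff_right ⟨D, hD⟩,
    isLinearlyStable_iff_of_charpoly_eq_prod hv hD hs,
    isLinearlyUnstable_iff_of_charpoly_eq_prod hv hD hs]
  push Not
  constructor
  · rintro ⟨⟨a, ha, ha0⟩, h⟩
    exact ⟨h, (h a ha).antisymm ha0 ▸ ha⟩
  · rintro ⟨h, h0⟩
    exact ⟨⟨0, h0, le_rfl⟩, h⟩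

end Stability

/-! ### Jacobian spectra -/

section Triangle

variable (e : Fin 3 ≃ triangleGraph.edgeSet) {α : ℝ} {v : Fin 3 → ℝ} {s : Multiset ℝ}

open Polynomial in
theorem IsTriangleEquilibrium.isLinearlyStable_comp_perm_iff (h : IsTriangleEquilibrium α v)
    (hα : 1 < α) (hs : (triangleJacobian α v).charpoly = (s.map fun a => X - C a).prod)
    (σ : Equiv.Perm (Fin 3)) :
    IsLinearlyStable (graphLaw triangleGraph e) (powerWeight α) (v ∘ σ) ↔ ∀ a ∈ s, a < 0 := by
  have h' := (isTriangleEquilibrium_comp_perm_iff σ).2 h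
  exact isLinearlyStable_iff_of_charpoly_eq_prod ((isEquilibrium_triangleGraph_iff e α _).2 h')
    (h'.hasJacobian hα e) ((charpoly_triangleJacobian_comp_perm α v σ).trans hs)

open Polynomial in
theorem IsTriangleEquilibrium.isCritical_comp_perm_iff (h : IsTriangleEquilibrium α v)
    (hα : 1 < α) (hs : (triangleJacobian α v).charpoly = (s.map fun a => X - C a).prod)
    (σ : Equiv.Perm (Fin 3)) :
    IsCritical (graphLaw triangleGraph e) (powerWeight α) (v ∘ σ) ↔
      (∀ a ∈ s, a ≤ 0) ∧ 0 ∈ s := by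
  have h' := (isTriangleEquilibrium_comp_perm_iff σ).2 h
  exact isCritical_iff_of_charpoly_eq_prod ((isEquilibrium_triangleGraph_iff e α _).2 h')
    (h'.hasJacobian hα e) ((charpoly_triangleJacobian_comp_perm α v σ).trans hs)

end Triangle

theorem share_one_left {α r : ℝ} : share α 1 r = 1 / (1 + r ^ α) := by
  rw [share, Real.one_rpow]

theorem share_one_right {α r : ℝ} : share α r 1 = r ^ α / (1 + r ^ α) := by
  rw [share, Real.one_rpow, add_comm]

section EqualPair

/-- The point of the simplex proportional to `(1, 1, r)`. -/
noncomputable def equalPairPoint (r : ℝ) : Fin 3 → ℝ := ![1 / (2 + r), 1 / (2 + r), r / (2 + r)]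

variable {α r : ℝ}

theorem isTriangleEquilibrium_equalPairPoint_iff (hr : 0 ≤ r) :
    IsTriangleEquilibrium α (equalPairPoint r) ↔ r ^ α * (4 - r) = 3 * r := by
  rw [equalPairPoint, isTriangleEquilibrium_vec_iff, share_self (by positivity),
    share_div_div zero_le_one hr (by positivity), share_div_div hr zero_le_one (by positivity),
    share_one_left, share_one_right]
  constructor
  · rintro ⟨-, -, -, h⟩
    field_simp at h
    linarith
  · intro h
    refine ⟨⟨⟨by positivity, by positivity, by positivity⟩, by field_simp; ring⟩, ?_, ?_, ?_⟩ <;>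
      field_simp <;> linarith

theorem shareVariance_equalPair (hr : 0 < r) (h : r ^ α * (4 - r) = 3 * r) :
    shareVariance α (1 / (2 + r)) (r / (2 + r)) = 3 * r * (4 - r) / (4 * (2 + r) ^ 2) := by
  have hfst : share α 1 r = (4 - r) / (2 * (2 + r)) := by
    rw [share_one_left, div_eq_div_iff (by positivity) (by positivity)]
    linarith
  have hsnd : share α r 1 = 3 * r / (2 * (2 + r)) := by
    rw [share_one_right, div_eq_div_iff (by positivity) (by positivity)]
    linear_combination h
  rw [shareVariance, share_div_div zero_le_one hr.le (by positivity),
    share_div_div hr.le zero_le_one (by positivity), hfst, hsnd]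
  field_simp
  ring

/-- The value of `α` above which the equilibrium `equalPairPoint r` is unstable in the direction
`(1, -1, 0)`; in the direction `(1, 1, -2)` this role is played by `equalPairElasticity r`. -/
noncomputable def equalPairSplitExponent (r : ℝ) : ℝ := 12 * (2 + r) / (8 + 20 * r - r ^ 2)

open Polynomial in
theorem charpoly_triangleJacobian_equalPairPoint (hr : 0 < r) (h : r ^ α * (4 - r) = 3 * r) :
    (triangleJacobian α (equalPairPoint r)).charpoly =
      (Multiset.map (fun a => X - C a)
        {-1, -1 + α / equalPairSplitExponent r, -1 + α / equalPairElasticity r}).prod := by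
  refine Polynomial.funext fun t => ?_
  have hself : shareVariance α (1 / (2 + r)) (1 / (2 + r)) = 1 / 4 := by
    rw [shareVariance, share_self (by positivity)]
    norm_num
  rw [equalPairPoint, eval_charpoly_triangleJacobian, hself, shareVariance_equalPair hr h]
  simp only [equalPairSplitExponent, equalPairElasticity, div_div_eq_mul_div,
    Multiset.insert_eq_cons, Multiset.map_cons, Multiset.map_singleton, Multiset.prod_cons,
    Multiset.prod_singleton, eval_mul, eval_sub, eval_X, eval_C]
  field_simp
  ring

end EqualPair

section OneZero

/-- The point of the simplex proportional to `(r, 1, 0)`. -/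
noncomputable def oneZeroPoint (r : ℝ) : Fin 3 → ℝ := ![r / (1 + r), 1 / (1 + r), 0]

variable {α r : ℝ}

theorem isTriangleEquilibrium_oneZeroPoint_iff (hα : α ≠ 0) (hr : 0 < r) :
    IsTriangleEquilibrium α (oneZeroPoint r) ↔ r ^ α * (2 - r) = 2 * r - 1 := by
  rw [oneZeroPoint, isTriangleEquilibrium_vec_iff, share_div_div hr.le zero_le_one (by positivity),
    share_div_div zero_le_one hr.le (by positivity), share_one_left, share_one_right,
    share_zero_right hα (by positivity), share_zero_right hα (by positivity), share_zero_left hα,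
    share_zero_left hα]
  constructor
  · rintro ⟨-, h, -⟩
    field_simp at h
    linarith
  · intro h
    refine ⟨⟨⟨by positivity, by positivity, le_rfl⟩, by field_simp; ring⟩, ?_, ?_, by norm_num⟩ <;>
      field_simp <;> linarith

theorem shareVariance_oneZero (hr : 0 < r) (h : r ^ α * (2 - r) = 2 * r - 1) :
    shareVariance α (r / (1 + r)) (1 / (1 + r)) = (2 * r - 1) * (2 - r) / (1 + r) ^ 2 := by
  have hfst : share α r 1 = (2 * r - 1) / (1 + r) := by
    rw [share_one_right, div_eq_div_iff (by positivity) (by positivity)]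
    linarith
  have hsnd : share α 1 r = (2 - r) / (1 + r) := by
    rw [share_one_left, div_eq_div_iff (by positivity) (by positivity)]
    linarith
  rw [shareVariance, share_div_div zero_le_one hr.le (by positivity),
    share_div_div hr.le zero_le_one (by positivity), hfst, hsnd]
  field_simp

open Polynomial in
theorem charpoly_triangleJacobian_oneZeroPoint (hα : α ≠ 0) (hr : 0 < r)
    (h : r ^ α * (2 - r) = 2 * r - 1) :
    (triangleJacobian α (oneZeroPoint r)).charpoly =
      (Multiset.map (fun a => X - C a) {-1, -1, -1 + α / oneZeroElasticity r}).prod := by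
  refine Polynomial.funext fun t => ?_
  have hzero : ∀ a, shareVariance α a 0 = 0 := fun a => by
    rw [shareVariance, share_zero_left hα, mul_zero]
  rw [oneZeroPoint, eval_charpoly_triangleJacobian, hzero, hzero, shareVariance_oneZero hr h]
  simp only [oneZeroElasticity, Multiset.insert_eq_cons, Multiset.map_cons,
    Multiset.map_singleton, Multiset.prod_cons, Multiset.prod_singleton, eval_mul, eval_sub,
    eval_X, eval_C, div_zero, mul_zero, add_zero]
  field_simp
  ring

end OneZero

section EqualPair

variable (e : Fin 3 ≃ triangleGraph.edgeSet) {α r : ℝ}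

theorem equalPairElasticity_pos (hr : r < 4) : 0 < equalPairElasticity r :=
  div_pos (by norm_num) (sub_pos.2 hr)

theorem equalPairSplitExponent_pos (hr : 0 < r) (hr4 : r < 4) : 0 < equalPairSplitExponent r :=
  div_pos (by positivity) (by nlinarith)

theorem isLinearlyStable_equalPairPoint_comp_perm_iff (hα : 1 < α) (hr : 0 < r)
    (h : r ^ α * (4 - r) = 3 * r) (σ : Equiv.Perm (Fin 3)) :
    IsLinearlyStable (graphLaw triangleGraph e) (powerWeight α) (equalPairPoint r ∘ σ) ↔
      α < min (equalPairSplitExponent r) (equalPairElasticity r) := by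
  have hr4 := lt_four_of_rpow_mul_four_sub_eq hr h
  rw [((isTriangleEquilibrium_equalPairPoint_iff hr.le).2 h).isLinearlyStable_comp_perm_iff e hα
    (charpoly_triangleJacobian_equalPairPoint hr h)]
  simp [neg_add_lt_iff_lt_add, div_lt_one (equalPairElasticity_pos hr4),
    div_lt_one (equalPairSplitExponent_pos hr hr4)]

theorem isCritical_equalPairPoint_comp_perm_iff (hα : 1 < α) (hr : 0 < r)
    (h : r ^ α * (4 - r) = 3 * r) (σ : Equiv.Perm (Fin 3)) :
    IsCritical (graphLaw triangleGraph e) (powerWeight α) (equalPairPoint r ∘ σ) ↔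
      α = min (equalPairSplitExponent r) (equalPairElasticity r) := by
  have hr4 := lt_four_of_rpow_mul_four_sub_eq hr h
  have hE := equalPairElasticity_pos hr4
  have hT := equalPairSplitExponent_pos hr hr4
  rw [((isTriangleEquilibrium_equalPairPoint_iff hr.le).2 h).isCritical_comp_perm_iff e hα
    (charpoly_triangleJacobian_equalPairPoint hr h), eq_comm, min_eq_iff]
  simp only [neg_add_eq_sub, Multiset.insert_eq_cons, Multiset.mem_cons, Multiset.mem_singleton,
    forall_eq_or_imp, Left.neg_nonpos_iff, zero_le_one, tsub_le_iff_right, zero_add, forall_eq,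
    div_le_one hT, div_le_one hE, true_and, eq_comm (a := (0 : ℝ)), neg_eq_zero, one_ne_zero,
    sub_eq_zero, div_eq_one_iff_eq hT.ne', div_eq_one_iff_eq hE.ne', false_or]
  grind

theorem equalPairPoint_one : equalPairPoint 1 = ![1 / 3, 1 / 3, 1 / 3] := by
  norm_num [equalPairPoint]

theorem equalPairSplitExponent_one : equalPairSplitExponent 1 = 4 / 3 := by
  norm_num [equalPairSplitExponent]

theorem isLinearlyStable_third_iff (hα : 1 < α) :
    IsLinearlyStable (graphLaw triangleGraph e) (powerWeight α) ![1 / 3, 1 / 3, 1 / 3] ↔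
      α < 4 / 3 := by
  have := isLinearlyStable_equalPairPoint_comp_perm_iff e hα one_pos (by norm_num) (Equiv.refl _)
  rwa [equalPairPoint_one, equalPairSplitExponent_one, equalPairElasticity_one, min_self] at this

theorem isCritical_third_iff (hα : 1 < α) :
    IsCritical (graphLaw triangleGraph e) (powerWeight α) ![1 / 3, 1 / 3, 1 / 3] ↔
      α = 4 / 3 := by
  have := isCritical_equalPairPoint_comp_perm_iff e hα one_pos (by norm_num) (Equiv.refl _)
  rwa [equalPairPoint_one, equalPairSplitExponent_one, equalPairElasticity_one, min_self] at this

theorem equalPairSplitExponent_lt (hr : 1 < r) (hr4 : r < 4) :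
    equalPairSplitExponent r < 4 / 3 := by
  rw [equalPairSplitExponent, div_lt_div_iff₀ (by nlinarith) (by norm_num)]
  have : 0 < (r - 1) * (10 - r) := mul_pos (by linarith) (by linarith)
  linarith

theorem equalPairRatio_rpow_mul (hα : 1 < α) :
    equalPairRatio α ^ α * (4 - equalPairRatio α) = 3 * equalPairRatio α :=
  (rpow_mul_four_sub_eq_iff hα (equalPairRatio_mem hα).1).2 (Or.inr rfl)

theorem min_splitExponent_elasticity_lt (hα : 1 < α) (hα' : α ≠ 4 / 3) :
    min (equalPairSplitExponent (equalPairRatio α)) (equalPairElasticity (equalPairRatio α)) <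
      α := by
  rcases hα'.lt_or_gt with h | h
  · exact min_lt_of_right_lt (equalPairElasticity_equalPairRatio_lt hα h)
  · exact min_lt_of_left_lt ((equalPairSplitExponent_lt ((one_lt_equalPairRatio_iff hα).2 h)
      (equalPairRatio_mem hα).2).trans h)

theorem min_splitExponent_elasticity_four_thirds :
    min (equalPairSplitExponent (equalPairRatio (4 / 3)))
      (equalPairElasticity (equalPairRatio (4 / 3))) = 4 / 3 := by
  rw [equalPairRatio_four_thirds, equalPairSplitExponent_one, equalPairElasticity_one, min_self]

theorem not_isLinearlyStable_equalPairRatio (hα : 1 < α) (σ : Equiv.Perm (Fin 3)) :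
    ¬ IsLinearlyStable (graphLaw triangleGraph e) (powerWeight α)
      (equalPairPoint (equalPairRatio α) ∘ σ) := by
  rw [isLinearlyStable_equalPairPoint_comp_perm_iff e hα (equalPairRatio_mem hα).1
    (equalPairRatio_rpow_mul hα), not_lt]
  rcases eq_or_ne α (4 / 3) with rfl | hne
  · exact min_splitExponent_elasticity_four_thirds.le
  · exact (min_splitExponent_elasticity_lt hα hne).le

theorem isCritical_equalPairRatio_iff (hα : 1 < α) (σ : Equiv.Perm (Fin 3)) :
    IsCritical (graphLaw triangleGraph e) (powerWeight α)
      (equalPairPoint (equalPairRatio α) ∘ σ) ↔ α = 4 / 3 := by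
  rw [isCritical_equalPairPoint_comp_perm_iff e hα (equalPairRatio_mem hα).1
    (equalPairRatio_rpow_mul hα)]
  refine ⟨fun h => ?_, ?_⟩
  · by_contra hne
    exact (min_splitExponent_elasticity_lt hα hne).ne' h
  · rintro rfl
    exact min_splitExponent_elasticity_four_thirds.symm

end EqualPair

section OneZero

variable (e : Fin 3 ≃ triangleGraph.edgeSet) {α r : ℝ}

theorem oneZeroElasticity_pos (hr : 1 ≤ r) (hr2 : r < 2) : 0 < oneZeroElasticity r :=
  div_pos (by linarith) (mul_pos (by linarith) (by linarith))

theorem isLinearlyStable_oneZeroPoint_iff (hα : 1 < α) (hr : 1 ≤ r) (hr2 : r < 2)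
    (h : r ^ α * (2 - r) = 2 * r - 1) :
    IsLinearlyStable (graphLaw triangleGraph e) (powerWeight α) (oneZeroPoint r) ↔
      α < oneZeroElasticity r := by
  have hα0 := (zero_lt_one.trans hα).ne'
  have hr0 := zero_lt_one.trans_le hr
  refine (((isTriangleEquilibrium_oneZeroPoint_iff hα0 hr0).2 h).isLinearlyStable_comp_perm_iff e hα
    (charpoly_triangleJacobian_oneZeroPoint hα0 hr0 h) (Equiv.refl _)).trans ?_
  simp [neg_add_lt_iff_lt_add, div_lt_one (oneZeroElasticity_pos hr hr2)]

theorem oneZeroPoint_one : oneZeroPoint 1 = ![1 / 2, 1 / 2, 0] := by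
  norm_num [oneZeroPoint]

theorem isLinearlyStable_half_iff (hα : 1 < α) :
    IsLinearlyStable (graphLaw triangleGraph e) (powerWeight α) ![1 / 2, 1 / 2, 0] ↔ α < 3 := by
  rw [← oneZeroPoint_one, ← oneZeroElasticity_one]
  exact isLinearlyStable_oneZeroPoint_iff e hα le_rfl one_lt_two (by norm_num)

theorem isCritical_half_iff (hα : 1 < α) :
    IsCritical (graphLaw triangleGraph e) (powerWeight α) ![1 / 2, 1 / 2, 0] ↔ α = 3 := by
  have hα0 := (zero_lt_one.trans hα).ne'
  have h : (1 : ℝ) ^ α * (2 - 1) = 2 * 1 - 1 := by norm_num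
  rw [← oneZeroPoint_one]
  refine (((isTriangleEquilibrium_oneZeroPoint_iff hα0 one_pos).2 h).isCritical_comp_perm_iff e hα
    (charpoly_triangleJacobian_oneZeroPoint hα0 one_pos h) (Equiv.refl _)).trans ?_
  rw [oneZeroElasticity_one]
  have hiff : 0 = -1 + α / 3 ↔ α = 3 := by
    constructor <;> intro h <;> linarith
  simp only [Multiset.insert_eq_cons, Multiset.mem_cons, Multiset.mem_singleton, or_self_left,
    forall_eq_or_imp, Left.neg_nonpos_iff, zero_le_one, forall_eq, neg_add_le_iff_le_add, add_zero,
    Nat.ofNat_pos, div_le_one, true_and, zero_eq_neg, one_ne_zero, hiff, false_or,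
    and_iff_right_iff_imp]
  exact fun h => h.le

theorem oneZeroRatio_rpow_mul (hα : 3 < α) :
    oneZeroRatio α ^ α * (2 - oneZeroRatio α) = 2 * oneZeroRatio α - 1 :=
  (rpow_mul_two_sub_eq_iff (oneZeroRatio_mem hα).1).2 ⟨hα, rfl⟩

theorem isLinearlyStable_oneZeroRatio (hα : 3 < α) :
    IsLinearlyStable (graphLaw triangleGraph e) (powerWeight α) (oneZeroPoint (oneZeroRatio α)) :=
  (isLinearlyStable_oneZeroPoint_iff e (by linarith) (oneZeroRatio_mem hα).1.le
    (oneZeroRatio_mem hα).2 (oneZeroRatio_rpow_mul hα)).2 (lt_oneZeroElasticity_oneZeroRatio hα)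

end OneZero

/-! ### The branches -/

section Branches

variable {α : ℝ}

/-- The branch `v(α)` of the equilibria `(v, u, 0)`. -/
noncomputable def oneZeroBranch (α : ℝ) : ℝ := oneZeroRatio α / (1 + oneZeroRatio α)

/-- The branch `v(α)` of the equilibria `(v, v, u)`. -/
noncomputable def pairBranch (α : ℝ) : ℝ := 1 / (2 + equalPairRatio α)

/-- The branch `v(α)` of the equilibria `(v, u, u)`. -/
noncomputable def singleBranch (α : ℝ) : ℝ := equalPairRatio α / (2 + equalPairRatio α)

theorem oneZeroPoint_oneZeroRatio (hα : 3 < α) :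
    oneZeroPoint (oneZeroRatio α) = ![oneZeroBranch α, 1 - oneZeroBranch α, 0] := by
  have : 0 < 1 + oneZeroRatio α := by linarith [(oneZeroRatio_mem hα).1]
  rw [oneZeroPoint, oneZeroBranch, one_sub_div this.ne', add_sub_cancel_right]

theorem equalPairPoint_equalPairRatio (hα : 1 < α) :
    equalPairPoint (equalPairRatio α) = ![pairBranch α, pairBranch α, 1 - 2 * pairBranch α] := by
  have : 0 < 2 + equalPairRatio α := by linarith [(equalPairRatio_mem hα).1]
  rw [equalPairPoint, pairBranch, mul_one_div, one_sub_div this.ne', add_sub_cancel_left]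

theorem equalPairPoint_equalPairRatio_comp_swap (hα : 1 < α) :
    equalPairPoint (equalPairRatio α) ∘ Equiv.swap 0 2 =
      ![singleBranch α, (1 - singleBranch α) / 2, (1 - singleBranch α) / 2] := by
  have : 0 < 2 + equalPairRatio α := by linarith [(equalPairRatio_mem hα).1]
  have hhalf : (1 - singleBranch α) / 2 = 1 / (2 + equalPairRatio α) := by
    rw [singleBranch]
    field_simp
    ring
  rw [hhalf]
  ext i
  fin_cases i <;> rfl

theorem strictMonoOn_oneZeroBranch : StrictMonoOn oneZeroBranch (Ioi 3) := by
  intro α hα β hβ hαβ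
  have := (oneZeroRatio_mem hα).1
  have := (oneZeroRatio_mem hβ).1
  rw [oneZeroBranch, oneZeroBranch, div_lt_div_iff₀ (by linarith) (by linarith)]
  linarith [strictMonoOn_oneZeroRatio hα hβ hαβ]

theorem one_sub_oneZeroBranch_lt (hα : 3 < α) : 1 - oneZeroBranch α < oneZeroBranch α := by
  have := (oneZeroRatio_mem hα).1
  rw [oneZeroBranch, one_sub_div (by linarith), add_sub_cancel_right]
  gcongr

theorem tendsto_oneZeroBranch {l : Filter ℝ} {c : ℝ} (h : Tendsto oneZeroRatio l (𝓝 c))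
    (hc : 1 + c ≠ 0) : Tendsto oneZeroBranch l (𝓝 (c / (1 + c))) :=
  h.div (h.const_add 1) hc

theorem tendsto_oneZeroBranch_nhdsGT_three : Tendsto oneZeroBranch (𝓝[>] 3) (𝓝 (1 / 2)) := by
  convert! tendsto_oneZeroBranch tendsto_oneZeroRatio_nhdsGT_three (by norm_num) using 2
  norm_num

theorem tendsto_oneZeroBranch_atTop : Tendsto oneZeroBranch atTop (𝓝 (2 / 3)) := by
  convert! tendsto_oneZeroBranch tendsto_oneZeroRatio_atTop (by norm_num) using 2
  norm_num

theorem strictAntiOn_pairBranch : StrictAntiOn pairBranch (Ioi 1) := by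
  intro α hα β hβ hαβ
  have := (equalPairRatio_mem hα).1
  exact one_div_lt_one_div_of_lt (by linarith)
    (by linarith [strictMonoOn_equalPairRatio hα hβ hαβ])

theorem one_sub_two_mul_pairBranch_lt (hα : 1 < α) (hα' : α < 4 / 3) :
    1 - 2 * pairBranch α < pairBranch α := by
  have := (equalPairRatio_mem hα).1
  rw [pairBranch, mul_one_div, one_sub_div (by linarith), add_sub_cancel_left]
  gcongr
  exact (equalPairRatio_lt_one_iff hα).2 hα'

theorem tendsto_pairBranch {l : Filter ℝ} {c : ℝ} (h : Tendsto equalPairRatio l (𝓝 c))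
    (hc : 2 + c ≠ 0) : Tendsto pairBranch l (𝓝 (1 / (2 + c))) :=
  tendsto_const_nhds.div (h.const_add 2) hc

theorem tendsto_pairBranch_nhdsGT_one : Tendsto pairBranch (𝓝[>] 1) (𝓝 (1 / 2)) := by
  convert! tendsto_pairBranch tendsto_equalPairRatio_nhdsGT_one (by norm_num) using 2
  norm_num

theorem tendsto_pairBranch_four_thirds : Tendsto pairBranch (𝓝 (4 / 3)) (𝓝 (1 / 3)) := by
  convert! tendsto_pairBranch tendsto_equalPairRatio_four_thirds (by norm_num) using 2
  norm_num

theorem pairBranch_four_thirds : pairBranch (4 / 3) = 1 / 3 := by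
  rw [pairBranch, equalPairRatio_four_thirds]
  norm_num

theorem strictMonoOn_singleBranch : StrictMonoOn singleBranch (Ioi 1) := by
  intro α hα β hβ hαβ
  have := (equalPairRatio_mem hα).1
  have := (equalPairRatio_mem hβ).1
  rw [singleBranch, singleBranch, div_lt_div_iff₀ (by linarith) (by linarith)]
  linarith [strictMonoOn_equalPairRatio hα hβ hαβ]

theorem one_sub_singleBranch_div_two_lt (hα : 4 / 3 < α) :
    (1 - singleBranch α) / 2 < singleBranch α := by
  have hα1 : 1 < α := by linarith
  have := (equalPairRatio_mem hα1).1
  have hlt : 1 / 3 < singleBranch α := by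
    rw [singleBranch, div_lt_div_iff₀ (by norm_num) (by linarith)]
    linarith [(one_lt_equalPairRatio_iff hα1).2 hα]
  linarith

theorem tendsto_singleBranch {l : Filter ℝ} {c : ℝ} (h : Tendsto equalPairRatio l (𝓝 c))
    (hc : 2 + c ≠ 0) : Tendsto singleBranch l (𝓝 (c / (2 + c))) :=
  h.div (h.const_add 2) hc

theorem tendsto_singleBranch_four_thirds : Tendsto singleBranch (𝓝 (4 / 3)) (𝓝 (1 / 3)) := by
  convert! tendsto_singleBranch tendsto_equalPairRatio_four_thirds (by norm_num) using 2
  norm_num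

theorem tendsto_singleBranch_atTop : Tendsto singleBranch atTop (𝓝 (2 / 3)) := by
  convert! tendsto_singleBranch tendsto_equalPairRatio_atTop (by norm_num) using 2
  norm_num

theorem singleBranch_four_thirds : singleBranch (4 / 3) = 1 / 3 := by
  rw [singleBranch, equalPairRatio_four_thirds]
  norm_num

theorem isEquilibrium_twoEdgeGraph_oneZeroBranch (e : Fin 2 ≃ twoEdgeGraph.edgeSet) (hα : 3 < α) :
    IsEquilibrium (graphLaw twoEdgeGraph e) (powerWeight α)
      ![oneZeroBranch α, 1 - oneZeroBranch α] := by
  have hα0 : α ≠ 0 := by linarith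
  have hr : 0 < oneZeroRatio α := one_pos.trans (oneZeroRatio_mem hα).1
  have heq := (isTriangleEquilibrium_oneZeroPoint_iff hα0 hr).2 (oneZeroRatio_rpow_mul hα)
  have hu : 1 - oneZeroBranch α = 1 / (1 + oneZeroRatio α) :=
    congrFun (oneZeroPoint_oneZeroRatio hα).symm 1
  have hpos : 0 < oneZeroBranch α := div_pos hr (by linarith)
  have hpos' : 0 < 1 - oneZeroBranch α := hu ▸ by positivity
  rw [oneZeroPoint_oneZeroRatio hα, isTriangleEquilibrium_vec_iff, share_zero_right hα0 hpos,
    share_zero_right hα0 hpos'] at heq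
  obtain ⟨-, h0, h1, -⟩ := heq
  refine ⟨⟨?_, by simp⟩, fun i => ?_⟩
  · simpa [Fin.forall_fin_succ] using ⟨hpos.le, by linarith⟩
  · rw [warmField_twoEdgeGraph e α (by simpa [Fin.forall_fin_succ] using ⟨hpos, by linarith⟩)]
    fin_cases i <;> simp at h0 h1 ⊢ <;> linarith

end Branches

/-! ### Classification of the equilibria -/

section Distinct

theorem convexOn_rpow_of_nonpos {p : ℝ} (hp : p ≤ 0) : ConvexOn ℝ (Ioi 0) fun x : ℝ => x ^ p := by
  have hlog : ConvexOn ℝ (Ioi 0) fun x : ℝ => -p * -Real.log x :=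
    strictConcaveOn_log_Ioi.concaveOn.neg.smul (neg_nonneg.2 hp)
  have hexp : ∀ x ∈ Ioi (0 : ℝ), Real.exp (-p * -Real.log x) = x ^ p := fun x hx => by
    rw [Real.rpow_def_of_pos hx, neg_mul_neg, mul_comm]
  refine ConvexOn.congr ⟨convex_Ioi 0, fun x hx y hy a b ha hb hab => ?_⟩ hexp
  exact (Real.exp_le_exp.2 (hlog.2 hx hy ha hb hab)).trans
    (convexOn_exp.2 (mem_univ _) (mem_univ _) ha hb hab)

variable {α a b c : ℝ}

theorem rpow_secant_slope (ha : 0 < a) (hb : 0 < b) (hc : 0 < c) (hne : b ^ α ≠ a ^ α)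
    (h1 : 3 * a = share α a b + share α a c) (h2 : 3 * b = share α b a + share α b c) :
    (b / b ^ α - a / a ^ α) / (b ^ α - a ^ α) =
      -(1 / (3 * ((a ^ α + c ^ α) * (b ^ α + c ^ α)))) := by
  have hA := Real.rpow_pos_of_pos ha α
  have hB := Real.rpow_pos_of_pos hb α
  have hC := Real.rpow_pos_of_pos hc α
  rw [share, share] at h1 h2
  have ha' : a / a ^ α = (1 / (a ^ α + b ^ α) + 1 / (a ^ α + c ^ α)) / 3 := by
    rw [div_eq_iff hA.ne']
    linear_combination h1 / 3
  have hb' : b / b ^ α = (1 / (b ^ α + a ^ α) + 1 / (b ^ α + c ^ α)) / 3 := by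
    rw [div_eq_iff hB.ne']
    linear_combination h2 / 3
  rw [ha', hb', add_comm (b ^ α) (a ^ α), div_eq_iff (sub_ne_zero.2 hne)]
  field_simp
  ring

-- With `A = a ^ α` and so on, `a / A = A ^ (1 / α - 1)` is a convex function of `A`, whereas the
-- equilibrium equations make its secant slopes decrease.
theorem not_isTriangleEquilibrium_of_lt (hα : 1 < α) (hc : 0 < c) (hcb : c < b) (hba : b < a) :
    ¬ IsTriangleEquilibrium α ![a, b, c] := by
  rw [isTriangleEquilibrium_vec_iff]
  rintro ⟨-, h1, h2, h3⟩
  have hα0 : 0 < α := by linarith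
  have hb := hc.trans hcb
  have ha := hb.trans hba
  have hf : ∀ x : ℝ, 0 < x → (x ^ α) ^ ((1 - α) / α) = x / x ^ α := fun x hx => by
    rw [← Real.rpow_mul hx.le, mul_div_cancel₀ _ hα0.ne', Real.rpow_sub hx, Real.rpow_one]
  have hC := Real.rpow_pos_of_pos hc α
  have hA := Real.rpow_pos_of_pos ha α
  have hCB := Real.rpow_lt_rpow hc.le hcb hα0
  have hBA := Real.rpow_lt_rpow hb.le hba hα0
  have hslope := (convexOn_rpow_of_nonpos (p := (1 - α) / α)
    (div_nonpos_of_nonpos_of_nonneg (by linarith) hα0.le)).slope_mono_adjacent hC hA hCB hBA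
  rw [hf a ha, hf b hb, hf c hc,
    rpow_secant_slope hc hb ha hCB.ne' (by rw [h3, add_comm]) (by rw [h2, add_comm]),
    rpow_secant_slope hb ha hc hBA.ne' h2 h1, neg_le_neg_iff,
    one_div_le_one_div (by positivity) (by positivity)] at hslope
  nlinarith [mul_pos (add_pos hA hC) (sub_pos.2 (hCB.trans hBA))]

end Distinct

section Classification

variable {α a b c : ℝ}

theorem eq_equalPairPoint_div (hb : 0 < b) (hsum : b + b + c = 1) :
    ![b, b, c] = equalPairPoint (c / b) := by
  obtain rfl : c = 1 - 2 * b := by linarith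
  have : 2 + (1 - 2 * b) / b = 1 / b := by field_simp; ring
  rw [equalPairPoint, this, one_div_one_div, div_div_div_cancel_right₀ hb.ne', div_one]

theorem eq_oneZeroPoint_div (hb : 0 < b) (hsum : a + b = 1) :
    ![a, b, 0] = oneZeroPoint (a / b) := by
  have : 1 + a / b = 1 / b := by field_simp; linarith
  rw [oneZeroPoint, this, one_div_one_div, div_div_div_cancel_right₀ hb.ne', div_one]

theorem equalPairPoint_zero : equalPairPoint 0 = ![1 / 2, 1 / 2, 0] := by
  norm_num [equalPairPoint]

theorem IsTriangleEquilibrium.eq_of_eq_of_le (h : IsTriangleEquilibrium α ![b, b, c])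
    (hα : 1 < α) (hb : 0 < b) (hcb : c ≤ b) :
    ![b, b, c] = ![1 / 3, 1 / 3, 1 / 3] ∨ ![b, b, c] = ![1 / 2, 1 / 2, 0] ∨
      (α < 4 / 3 ∧ ![b, b, c] = equalPairPoint (equalPairRatio α)) := by
  obtain ⟨⟨⟨-, -, hc⟩, hsum⟩, -⟩ := isTriangleEquilibrium_vec_iff.1 h
  have hr := div_nonneg hc hb.le
  rw [eq_equalPairPoint_div hb hsum] at h ⊢
  have heq := (isTriangleEquilibrium_equalPairPoint_iff hr).1 h
  rcases hr.eq_or_lt with h0 | hpos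
  · exact .inr (.inl (by rw [← h0, equalPairPoint_zero]))
  rcases (div_le_one_of_le₀ hcb hb.le).eq_or_lt with h1 | hlt
  · exact .inl (by rw [h1, equalPairPoint_one])
  · have hρ := ((rpow_mul_four_sub_eq_iff hα hpos).1 heq).resolve_left hlt.ne
    exact .inr (.inr ⟨(equalPairRatio_lt_one_iff hα).1 (hρ ▸ hlt), by rw [hρ]⟩)

theorem IsTriangleEquilibrium.eq_of_lt_of_eq (h : IsTriangleEquilibrium α ![a, b, b])
    (hα : 1 < α) (hb : 0 < b) (hba : b < a) :
    4 / 3 < α ∧ ![a, b, b] = equalPairPoint (equalPairRatio α) ∘ Equiv.swap 0 2 := by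
  obtain ⟨⟨-, hsum⟩, -⟩ := isTriangleEquilibrium_vec_iff.1 h
  have hr : 1 < a / b := (one_lt_div hb).2 hba
  have hswap : ![a, b, b] = equalPairPoint (a / b) ∘ Equiv.swap 0 2 := by
    rw [← eq_equalPairPoint_div hb (by linarith)]
    ext i
    fin_cases i <;> rfl
  rw [hswap, isTriangleEquilibrium_comp_perm_iff,
    isTriangleEquilibrium_equalPairPoint_iff (by linarith),
    rpow_mul_four_sub_eq_iff hα (by linarith)] at h
  have hρ := h.resolve_left hr.ne'
  exact ⟨(one_lt_equalPairRatio_iff hα).1 (hρ ▸ hr), by rw [hswap, hρ]⟩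

theorem IsTriangleEquilibrium.eq_of_lt_of_zero (h : IsTriangleEquilibrium α ![a, b, 0])
    (hα : α ≠ 0) (hb : 0 < b) (hba : b < a) :
    3 < α ∧ ![a, b, 0] = oneZeroPoint (oneZeroRatio α) := by
  obtain ⟨⟨-, hsum⟩, -⟩ := isTriangleEquilibrium_vec_iff.1 h
  have hr : 1 < a / b := (one_lt_div hb).2 hba
  rw [eq_oneZeroPoint_div hb (by linarith)] at h ⊢
  rw [isTriangleEquilibrium_oneZeroPoint_iff hα (by linarith), rpow_mul_two_sub_eq_iff hr] at h
  exact ⟨h.1, by rw [h.2]⟩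

theorem IsTriangleEquilibrium.eq_of_le_of_le (h : IsTriangleEquilibrium α ![a, b, c])
    (hα : 1 < α) (hba : b ≤ a) (hcb : c ≤ b) :
    ![a, b, c] = ![1 / 3, 1 / 3, 1 / 3] ∨ ![a, b, c] = ![1 / 2, 1 / 2, 0] ∨
      (3 < α ∧ ![a, b, c] = oneZeroPoint (oneZeroRatio α)) ∨
      (α < 4 / 3 ∧ ![a, b, c] = equalPairPoint (equalPairRatio α)) ∨
      (4 / 3 < α ∧ ![a, b, c] = equalPairPoint (equalPairRatio α) ∘ Equiv.swap 0 2) := by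
  obtain ⟨⟨⟨-, -, hc⟩, hsum⟩, -⟩ := isTriangleEquilibrium_vec_iff.1 h
  have ha : 3 * a ≤ 2 := h.three_mul_le_two 0
  have hb : 0 < b := by linarith
  rcases hba.eq_or_lt with rfl | hba
  · have := h.eq_of_eq_of_le hα hb hcb
    tauto
  rcases hcb.eq_or_lt with rfl | hcb
  · exact .inr (.inr (.inr (.inr (h.eq_of_lt_of_eq hα hb hba))))
  rcases hc.eq_or_lt with rfl | hc
  · exact .inr (.inr (.inl (h.eq_of_lt_of_zero (by linarith) hb hba)))
  · exact absurd h (not_isTriangleEquilibrium_of_lt hα hc hcb hba)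

theorem exists_perm_comp_eq_of_antitone (v : Fin 3 → ℝ) :
    ∃ (σ : Equiv.Perm (Fin 3)) (a b c : ℝ), v ∘ σ = ![a, b, c] ∧ b ≤ a ∧ c ≤ b := by
  have hm := Tuple.monotone_sort fun i => -v i
  refine ⟨Tuple.sort fun i => -v i, _, _, _, List.ofFn_inj.1 rfl, ?_, ?_⟩
  · exact neg_le_neg_iff.1 (hm (show (0 : Fin 3) ≤ 1 by decide))
  · exact neg_le_neg_iff.1 (hm (show (1 : Fin 3) ≤ 2 by decide))

theorem isTriangleEquilibrium_third : IsTriangleEquilibrium α ![1 / 3, 1 / 3, 1 / 3] := by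
  rw [← equalPairPoint_one, isTriangleEquilibrium_equalPairPoint_iff zero_le_one]
  norm_num

theorem isTriangleEquilibrium_half (hα : α ≠ 0) : IsTriangleEquilibrium α ![1 / 2, 1 / 2, 0] := by
  rw [← oneZeroPoint_one, isTriangleEquilibrium_oneZeroPoint_iff hα one_pos]
  norm_num

theorem isTriangleEquilibrium_oneZeroRatio (hα : 3 < α) :
    IsTriangleEquilibrium α (oneZeroPoint (oneZeroRatio α)) :=
  (isTriangleEquilibrium_oneZeroPoint_iff (by linarith)
    (one_pos.trans (oneZeroRatio_mem hα).1)).2 (oneZeroRatio_rpow_mul hα)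

theorem isTriangleEquilibrium_equalPairRatio (hα : 1 < α) :
    IsTriangleEquilibrium α (equalPairPoint (equalPairRatio α)) :=
  (isTriangleEquilibrium_equalPairPoint_iff (equalPairRatio_mem hα).1.le).2
    (equalPairRatio_rpow_mul hα)

theorem isTriangleEquilibrium_iff (hα : 1 < α) (v : Fin 3 → ℝ) :
    IsTriangleEquilibrium α v ↔ ∃ σ : Equiv.Perm (Fin 3),
      v ∘ σ = ![1 / 3, 1 / 3, 1 / 3] ∨ v ∘ σ = ![1 / 2, 1 / 2, 0] ∨
      (3 < α ∧ v ∘ σ = oneZeroPoint (oneZeroRatio α)) ∨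
      (α ≤ 4 / 3 ∧ v ∘ σ = equalPairPoint (equalPairRatio α)) ∨
      (4 / 3 ≤ α ∧ v ∘ σ = equalPairPoint (equalPairRatio α) ∘ Equiv.swap 0 2) := by
  constructor
  · intro h
    obtain ⟨σ, a, b, c, hσ, hba, hcb⟩ := exists_perm_comp_eq_of_antitone v
    have hclass := (hσ ▸ (isTriangleEquilibrium_comp_perm_iff σ).2 h).eq_of_le_of_le hα hba hcb
    rw [← hσ] at hclass
    exact ⟨σ, hclass.imp_right <| .imp_right <| .imp_right <|
      .imp (And.imp_left le_of_lt) (And.imp_left le_of_lt)⟩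
  · rintro ⟨σ, h⟩
    rw [← isTriangleEquilibrium_comp_perm_iff σ]
    rcases h with h | h | ⟨h3, h⟩ | ⟨-, h⟩ | ⟨-, h⟩ <;> rw [h]
    · exact isTriangleEquilibrium_third
    · exact isTriangleEquilibrium_half (by linarith)
    · exact isTriangleEquilibrium_oneZeroRatio h3
    · exact isTriangleEquilibrium_equalPairRatio hα
    · exact (isTriangleEquilibrium_comp_perm_iff _).2 (isTriangleEquilibrium_equalPairRatio hα)

theorem isEquilibrium_triangleGraph_iff_exists_perm (hα : 1 < α) (e : Fin 3 ≃ triangleGraph.edgeSet)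
    (v : Fin 3 → ℝ) :
    IsEquilibrium (graphLaw triangleGraph e) (powerWeight α) v ↔ ∃ σ : Equiv.Perm (Fin 3),
      v ∘ σ = ![1 / 3, 1 / 3, 1 / 3] ∨ v ∘ σ = ![1 / 2, 1 / 2, 0] ∨
      (3 < α ∧ v ∘ σ = ![oneZeroBranch α, 1 - oneZeroBranch α, 0]) ∨
      (α ≤ 4 / 3 ∧ v ∘ σ = ![pairBranch α, pairBranch α, 1 - 2 * pairBranch α]) ∨
      (4 / 3 ≤ α ∧
        v ∘ σ = ![singleBranch α, (1 - singleBranch α) / 2, (1 - singleBranch α) / 2]) := by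
  have hthree : ∀ w, 3 < α ∧ w = ![oneZeroBranch α, 1 - oneZeroBranch α, 0] ↔
      3 < α ∧ w = oneZeroPoint (oneZeroRatio α) := fun w =>
    and_congr_right fun h => by rw [oneZeroPoint_oneZeroRatio h]
  simp only [hthree, ← equalPairPoint_equalPairRatio hα,
    ← equalPairPoint_equalPairRatio_comp_swap hα]
  exact (isEquilibrium_triangleGraph_iff e α v).trans (isTriangleEquilibrium_iff hα v)

end Classification

theorem theorem10 :
    ∃ v₃ v₄ v₅ : ℝ → ℝ,
      -- the branch `(v, u, 0)` on `α > 3`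
      (StrictMonoOn v₃ (Ioi 3) ∧ (∀ α > 3, 1 - v₃ α < v₃ α) ∧
        Tendsto v₃ (𝓝[>] 3) (𝓝 (1 / 2)) ∧ Tendsto v₃ atTop (𝓝 (2 / 3)) ∧
        ∀ α > 3, ∀ e : Fin 2 ≃ twoEdgeGraph.edgeSet,
          IsEquilibrium (graphLaw twoEdgeGraph e) (powerWeight α) ![v₃ α, 1 - v₃ α]) ∧
      -- the branch `(v, v, u)` on `1 < α ≤ 4 / 3`
      (StrictAntiOn v₄ (Ioc 1 (4 / 3)) ∧ (∀ α, 1 < α → α < 4 / 3 → 1 - 2 * v₄ α < v₄ α) ∧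
        Tendsto v₄ (𝓝[>] 1) (𝓝 (1 / 2)) ∧ Tendsto v₄ (𝓝[<] (4 / 3)) (𝓝 (1 / 3)) ∧
        v₄ (4 / 3) = 1 / 3) ∧
      -- the branch `(v, u, u)` on `α ≥ 4 / 3`
      (StrictMonoOn v₅ (Ici (4 / 3)) ∧ (∀ α > 4 / 3, (1 - v₅ α) / 2 < v₅ α) ∧
        Tendsto v₅ (𝓝[>] (4 / 3)) (𝓝 (1 / 3)) ∧ Tendsto v₅ atTop (𝓝 (2 / 3)) ∧
        v₅ (4 / 3) = 1 / 3) ∧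
      ∀ α : ℝ, 1 < α → ∀ e : Fin 3 ≃ triangleGraph.edgeSet,
        -- the complete list of equilibria, up to a permutation of the coordinates
        (∀ x : Fin 3 → ℝ, IsEquilibrium (graphLaw triangleGraph e) (powerWeight α) x ↔
          ∃ σ : Equiv.Perm (Fin 3),
            x ∘ σ = ![1 / 3, 1 / 3, 1 / 3] ∨
            x ∘ σ = ![1 / 2, 1 / 2, 0] ∨
            (3 < α ∧ x ∘ σ = ![v₃ α, 1 - v₃ α, 0]) ∨
            (α ≤ 4 / 3 ∧ x ∘ σ = ![v₄ α, v₄ α, 1 - 2 * v₄ α]) ∨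
            (4 / 3 ≤ α ∧ x ∘ σ = ![v₅ α, (1 - v₅ α) / 2, (1 - v₅ α) / 2])) ∧
        -- at every equilibrium all the partial derivatives exist
        (∀ x : Fin 3 → ℝ, IsEquilibrium (graphLaw triangleGraph e) (powerWeight α) x →
          ∃ D, HasJacobian (graphLaw triangleGraph e) (powerWeight α) x D) ∧
        -- stability
        (IsLinearlyStable (graphLaw triangleGraph e) (powerWeight α) ![1 / 3, 1 / 3, 1 / 3] ↔
          α < 4 / 3) ∧
        (IsCritical (graphLaw triangleGraph e) (powerWeight α) ![1 / 3, 1 / 3, 1 / 3] ↔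
          α = 4 / 3) ∧
        (IsLinearlyStable (graphLaw triangleGraph e) (powerWeight α) ![1 / 2, 1 / 2, 0] ↔
          α < 3) ∧
        (IsCritical (graphLaw triangleGraph e) (powerWeight α) ![1 / 2, 1 / 2, 0] ↔
          α = 3) ∧
        (3 < α →
          IsLinearlyStable (graphLaw triangleGraph e) (powerWeight α) ![v₃ α, 1 - v₃ α, 0]) ∧
        (α ≤ 4 / 3 →
          ¬ IsLinearlyStable (graphLaw triangleGraph e) (powerWeight α)
              ![v₄ α, v₄ α, 1 - 2 * v₄ α] ∧
          (IsCritical (graphLaw triangleGraph e) (powerWeight α)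
              ![v₄ α, v₄ α, 1 - 2 * v₄ α] ↔ α = 4 / 3)) ∧
        (4 / 3 ≤ α →
          ¬ IsLinearlyStable (graphLaw triangleGraph e) (powerWeight α)
              ![v₅ α, (1 - v₅ α) / 2, (1 - v₅ α) / 2] ∧
          (IsCritical (graphLaw triangleGraph e) (powerWeight α)
              ![v₅ α, (1 - v₅ α) / 2, (1 - v₅ α) / 2] ↔ α = 4 / 3)) := by
  refine ⟨oneZeroBranch, pairBranch, singleBranch,
    ⟨strictMonoOn_oneZeroBranch, fun _ => one_sub_oneZeroBranch_lt,
      tendsto_oneZeroBranch_nhdsGT_three, tendsto_oneZeroBranch_atTop,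
      fun _ hα e => isEquilibrium_twoEdgeGraph_oneZeroBranch e hα⟩,
    ⟨strictAntiOn_pairBranch.mono Ioc_subset_Ioi_self, fun _ => one_sub_two_mul_pairBranch_lt,
      tendsto_pairBranch_nhdsGT_one, tendsto_pairBranch_four_thirds.mono_left nhdsWithin_le_nhds,
      pairBranch_four_thirds⟩,
    ⟨strictMonoOn_singleBranch.mono (Ici_subset_Ioi.2 (by norm_num)),
      fun _ => one_sub_singleBranch_div_two_lt,
      tendsto_singleBranch_four_thirds.mono_left nhdsWithin_le_nhds, tendsto_singleBranch_atTop,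
      singleBranch_four_thirds⟩,
    fun α hα e => ⟨isEquilibrium_triangleGraph_iff_exists_perm hα e,
      fun x hx => ⟨_, ((isEquilibrium_triangleGraph_iff e α x).1 hx).hasJacobian hα e⟩,
      isLinearlyStable_third_iff e hα, isCritical_third_iff e hα,
      isLinearlyStable_half_iff e hα, isCritical_half_iff e hα, fun h => ?_, fun _ => ?_,
      fun _ => ?_⟩⟩
  · exact oneZeroPoint_oneZeroRatio h ▸ isLinearlyStable_oneZeroRatio e h
  · rw [← equalPairPoint_equalPairRatio hα]
    exact ⟨not_isLinearlyStable_equalPairRatio e hα (Equiv.refl _),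
      isCritical_equalPairRatio_iff e hα (Equiv.refl _)⟩
  · rw [← equalPairPoint_equalPairRatio_comp_swap hα]
    exact ⟨not_isLinearlyStable_equalPairRatio e hα (Equiv.swap 0 2),
      isCritical_equalPairRatio_iff e hα (Equiv.swap 0 2)⟩
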